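/- **Setting.** Let $S_n$ be the symmetric group with simple generators $s_i=(i\ i{+}1)$, length function $\ell$, and reflections the transpositions. The Bruhat graph $\Gamma$ has vertex set $S_n$ and an edge $x\to y$, labeled by $yx^{-1}$, whenever $yx^{-1}$ is a reflection and $\ell(x)<\ell(y)$; Bruhat order is $x\le y$ iff there is a directed path from $x$ to $y$ in $\Gamma$, and $\Gamma(u,v)$ is the induced subgraph on $[u,v]$. Let $R_{u,v}\in\mathbb Z[q]$ be the Kazhdan–Lusztig $R$-polynomials: $R_{u,v}=0$ if $u\not\le v$, $R_{u,u}=1$, and if $u<v$ and $s$ is a simple generator with $sv<v$, then $R_{u,v}=R_{su,sv}$ if $su<u$ and $R_{u,v}=(q-1)R_{u,sv}+qR_{su,sv}$ if $su>u$. Let $\widetilde R_{u,v}$ be the unique polynomial with $R_{u,v}(q)=q^{(\ell(v)-\ell(u))/2}\,\widetilde R_{u,v}(q^{1/2}-q^{-1/2})$. A $k$-hypercube in $\Gamma(u,v)$ is a (not necessarily induced) subgraph isomorphic, as a directed graph, to the Hasse diagram of the Boolean lattice of subsets of a $k$-element set; it is spanned by the set of endpoints of its edges going out of its bottom vertex.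 A diamond is a $2$-hypercube. A set $I\subseteq[u,v]$ is diamond-closed if, whenever it contains three vertices of a diamond in $\Gamma(u,v)$, it contains the fourth. An order ideal of $[u,v]$ is a subset $I\subseteq [u,v]$ such that $b\in[u,v]$, $b\le a\in I$ imply $b\in I$. For $x\in I$ let $\mathcal Y_x=\{y\in[u,v]\setminus I : x\to y\}$, and let $\mathcal A_x$ be the set of all $Y\subseteq\mathcal Y_x$ that are antichains in Bruhat order. There is a hypercube cluster at $x$ (relative to $I$) if for every $Y\in\mathcal A_x$ there is a unique hypercube in $\Gamma(u,v)$ with bottom vertex $x$ spanned by $Y$; then $\theta_x(Y)$ denotes its top vertex. The cluster is * *strong* if for all $Y_1,Y_2\in\mathcal A_x$ with $|Y_1|=|Y_2|=|Y_1\cap Y_2|+1$ and all $w\in[u,v]$: if $\theta_x(Y_1)\ne\theta_x(Y_2)$ and $\theta_x(Y_1\cap Y_2)\to\theta_x(Y_i)\to w$ for $i=1,2$, then $Y_1\cup Y_2$ is an antichain and $\theta_x(Y_1\cup Y_2)=w$; * said to satisfy *property (E)* if there is a reflection order $\prec$ (a total order on the transpositions such that for all $a<b<c$ either $(a\,b)\prec(a\,c)\prec(b\,c)$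 or $(b\,c)\prec(a\,c)\prec(a\,b)$) such that $t_1\prec t_2$ whenever $x_1\xrightarrow{t_1}x_2$ and $x_3\xrightarrow{t_2}y$ are edges of $\Gamma$ with $x_1,x_2,x_3\in I\cap[x,v]$ and $y\in[x,v]\setminus I$. The relative $\widetilde R$-polynomial is $\widetilde R_{x,v,I}(q)=\sum_{y\in I\cap[x,v]}\widetilde R_{x,y}(-q)\,\widetilde R_{y,v}(q)$. **Theorem.** Let $I$ be a diamond-closed order ideal of a Bruhat interval $[u,v]$ in $S_n$, and let $x\in I$ be such that there is a hypercube cluster at $x$ relative to $I$ which is strong and satisfies property (E). Then $$\widetilde R_{x,v,I}(q)=\sum_{\substack{Y\in\mathcal A_x\\ \theta_x(Y)=v}}q^{|Y|}.$$ -/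

import Mathlib

open Polynomial

namespace BruhatHypercube

/-! ### The symmetric group as a Coxeter group: length, Bruhat graph, Bruhat order -/

/-- The symmetric group `S_n`, acting on `{0, …, n-1}`; products are compositions of functions. -/
abbrev Sym (n : ℕ) : Type := Equiv.Perm (Fin n)

/-- The simple generators of `S_n`: the adjacent transpositions `(i i+1)`. -/
def IsSimple {n : ℕ} (s : Sym n) : Prop :=
  ∃ i j : Fin n, (j : ℕ) = (i : ℕ) + 1 ∧ s = Equiv.swap i j

/-- The Coxeter length: the least number of simple generators in a word with product `w`. -/
noncomputable def length {n : ℕ} (w : Sym n) : ℕ :=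
  sInf {k : ℕ | ∃ l : List (Sym n), (∀ s ∈ l, IsSimple s) ∧ l.prod = w ∧ l.length = k}

/-- The reflections of `S_n`, i.e. the transpositions. -/
abbrev Reflection (n : ℕ) : Type := {t : Sym n // t.IsSwap}

/-- The edges `x → y` of the Bruhat graph `Γ`; such an edge is labeled by `y * x⁻¹`. -/
def Edge {n : ℕ} (x y : Sym n) : Prop :=
  (y * x⁻¹).IsSwap ∧ length x < length y

/-- The Bruhat order: there is a directed path from `x` to `y` in the Bruhat graph. -/
def BruhatLE {n : ℕ} (x y : Sym n) : Prop :=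
  Relation.ReflTransGen Edge x y

/-- Membership in the Bruhat interval `[u, v]`. -/
def InInterval {n : ℕ} (u v x : Sym n) : Prop :=
  BruhatLE u x ∧ BruhatLE x v

/-! ### `R`-polynomials and `R̃`-polynomials -/

open Classical in
/-- The Kazhdan–Lusztig `R`-polynomial `R_{u,v}`, computed by the Kazhdan–Lusztig recurrence. The
recurrence holds for every simple `s` with `s * v < v`; here one such `s` is chosen for each `v`.
(The last branch is never reached, since a permutation `v ≠ 1` has a left descent.) -/
noncomputable def RPoly {n : ℕ} (u v : Sym n) : ℤ[X] :=
  if ¬ BruhatLE u v then 0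
  else if u = v then 1
  else if h : ∃ s : Sym n, IsSimple s ∧ length (s * v) < length v then
    if length (h.choose * u) < length u then
      RPoly (h.choose * u) (h.choose * v)
    else
      (X - 1) * RPoly u (h.choose * v) + X * RPoly (h.choose * u) (h.choose * v)
  else 0
termination_by length v
decreasing_by all_goals exact h.choose_spec.2

/-- The relation `R_{u,v}(q) = q^{ℓ(u,v)/2} P(q^{1/2} - q^{-1/2})`, where
`ℓ(u,v) = ℓ(v) - ℓ(u)`, as an identity of Laurent polynomials in `q^{1/2} = T 1`. -/
def IsRTilde {n : ℕ} (u v : Sym n) (P : ℤ[X]) : Prop :=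
  aeval (LaurentPolynomial.T 2 : LaurentPolynomial ℤ) (RPoly u v) =
    LaurentPolynomial.T ((length v : ℤ) - (length u : ℤ)) *
      aeval (LaurentPolynomial.T 1 - LaurentPolynomial.T (-1) : LaurentPolynomial ℤ) P

/-- The polynomial `R̃_{u,v}`: the unique `P` with
`R_{u,v}(q) = q^{ℓ(u,v)/2} P(q^{1/2} - q^{-1/2})`. -/
noncomputable def RTilde {n : ℕ} (u v : Sym n) : ℤ[X] :=
  Classical.epsilon fun P => IsRTilde u v P

open Classical in
/-- The relative `R̃`-polynomial `∑ R̃_{x,y}(-q) R̃_{y,v}(q)`, summed over `y ∈ I ∩ [x, v]`. -/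
noncomputable def relRTilde {n : ℕ} (x v : Sym n) (I : Finset (Sym n)) : ℤ[X] :=
  ∑ y ∈ I with InInterval x v y, (RTilde x y).comp (-X) * RTilde y v

/-! ### Hypercubes in the Bruhat graph -/

/-- A (not necessarily induced) subgraph of `Γ(u,v)`, the Bruhat graph on the interval `[u, v]`. -/
@[ext]
structure Subgraph {n : ℕ} (u v : Sym n) where
  verts : Set (Sym n)
  Adj : Sym n → Sym n → Prop
  verts_mem : ∀ a ∈ verts, InInterval u v a
  adj_verts : ∀ a b, Adj a b → a ∈ verts ∧ b ∈ verts
  adj_edge : ∀ a b, Adj a b → Edge a b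

/-- Isomorphisms of directed graphs from the hypercube graph, the Hasse diagram of the Boolean
lattice of subsets of a `k`-element set, to the subgraph `H`. -/
abbrev CubeIso {n : ℕ} {u v : Sym n} (k : ℕ) (H : Subgraph u v) : Type :=
  (fun A B : Finset (Fin k) => A ⋖ B) ≃r (fun a b : H.verts => H.Adj a b)

/-- `H` is a diamond, i.e. a `2`-hypercube. -/
def IsDiamond {n : ℕ} {u v : Sym n} (H : Subgraph u v) : Prop :=
  Nonempty (CubeIso 2 H)

/-- `H` is a hypercube with bottom vertex `x`, spanned by `Y` (the set of endpoints of the edges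
of `H` going out of `x`), and with top vertex `w`. -/
def IsCubeWith {n : ℕ} {u v : Sym n} (H : Subgraph u v) (x : Sym n) (Y : Finset (Sym n))
    (w : Sym n) : Prop :=
  ∃ (k : ℕ) (φ : CubeIso k H),
    (φ ∅ : Sym n) = x ∧ (∀ y, y ∈ Y ↔ H.Adj x y) ∧ (φ Finset.univ : Sym n) = w

/-- `I` is an order ideal of the Bruhat interval `[u, v]`. -/
def IsOrderIdeal {n : ℕ} (u v : Sym n) (I : Finset (Sym n)) : Prop :=
  (∀ a ∈ I, InInterval u v a) ∧
    ∀ a ∈ I, ∀ b, InInterval u v b → BruhatLE b a → b ∈ I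

/-- Whenever `I` contains three vertices of a diamond in `Γ(u,v)`, it contains the fourth. -/
def DiamondClosed {n : ℕ} (u v : Sym n) (I : Finset (Sym n)) : Prop :=
  ∀ H : Subgraph u v, IsDiamond H →
    ∀ d ∈ H.verts, (∀ a ∈ H.verts, a ≠ d → a ∈ I) → d ∈ I

/-! ### Hypercube clusters -/

open Classical in
/-- The set `𝒜_x` of all antichains, in Bruhat order, contained in
`𝒴_x = {y ∈ [u,v] ∖ I | x → y}`. -/
noncomputable def antichains {n : ℕ} (u v : Sym n) (I : Finset (Sym n)) (x : Sym n) :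
    Finset (Finset (Sym n)) :=
  {Y : Finset (Sym n) | (∀ y ∈ Y, InInterval u v y ∧ y ∉ I ∧ Edge x y) ∧
    IsAntichain BruhatLE (Y : Set (Sym n))}

/-- There is a hypercube cluster at `x` relative to `I`: every `Y ∈ 𝒜_x` spans a unique hypercube
in `Γ(u,v)` with bottom vertex `x`. -/
def HasHypercubeCluster {n : ℕ} (u v : Sym n) (I : Finset (Sym n)) (x : Sym n) : Prop :=
  ∀ Y ∈ antichains u v I x, ∃! H : Subgraph u v, ∃ w, IsCubeWith H x Y w

/-- The hypercube map `θ_x`: the top vertex of the hypercube in `Γ(u,v)` with bottom vertex `x`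
spanned by `Y` (an arbitrary element if there is no such hypercube). -/
noncomputable def theta {n : ℕ} (u v x : Sym n) (Y : Finset (Sym n)) : Sym n :=
  Classical.epsilon fun w => ∃ H : Subgraph u v, IsCubeWith H x Y w

/-- Strongness of a hypercube cluster at `x`. -/
def IsStrong {n : ℕ} (u v : Sym n) (I : Finset (Sym n)) (x : Sym n) : Prop :=
  ∀ Y₁ ∈ antichains u v I x, ∀ Y₂ ∈ antichains u v I x,
    Y₁.card = (Y₁ ∩ Y₂).card + 1 → Y₂.card = (Y₁ ∩ Y₂).card + 1 →
    ∀ w, InInterval u v w →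
      theta u v x Y₁ ≠ theta u v x Y₂ →
      Edge (theta u v x (Y₁ ∩ Y₂)) (theta u v x Y₁) →
      Edge (theta u v x (Y₁ ∩ Y₂)) (theta u v x Y₂) →
      Edge (theta u v x Y₁) w → Edge (theta u v x Y₂) w →
      Y₁ ∪ Y₂ ∈ antichains u v I x ∧ theta u v x (Y₁ ∪ Y₂) = w

/-- The transposition `(a b)`, for `a < b`, as a reflection. -/
def transposition {n : ℕ} (a b : Fin n) (h : a < b) : Reflection n :=
  ⟨Equiv.swap a b, a, b, h.ne, rfl⟩

/-- Reflection orders: strict total orders `≺` on the reflections such that for all `a < b < c`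
either `(a b) ≺ (a c) ≺ (b c)` or `(b c) ≺ (a c) ≺ (a b)`. -/
def IsReflectionOrder {n : ℕ} (r : Reflection n → Reflection n → Prop) : Prop :=
  IsStrictTotalOrder (Reflection n) r ∧
    ∀ (a b c : Fin n) (hab : a < b) (hbc : b < c),
      (r (transposition a b hab) (transposition a c (hab.trans hbc)) ∧
        r (transposition a c (hab.trans hbc)) (transposition b c hbc)) ∨
      (r (transposition b c hbc) (transposition a c (hab.trans hbc)) ∧
        r (transposition a c (hab.trans hbc)) (transposition a b hab))

/-- Property (E) at `x`: for some reflection order, the labels of all edges inside `I ∩ [x,v]`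
precede the labels of all edges from `I ∩ [x,v]` to `[x,v] ∖ I`. -/
def PropertyE {n : ℕ} (v : Sym n) (I : Finset (Sym n)) (x : Sym n) : Prop :=
  ∃ r : Reflection n → Reflection n → Prop, IsReflectionOrder r ∧
    ∀ (x₁ x₂ x₃ y : Sym n) (e₁ : Edge x₁ x₂) (e₂ : Edge x₃ y),
      x₁ ∈ I → InInterval x v x₁ → x₂ ∈ I → InInterval x v x₂ → x₃ ∈ I → InInterval x v x₃ →
      y ∉ I → InInterval x v y →
      r ⟨x₂ * x₁⁻¹, e₁.1⟩ ⟨y * x₃⁻¹, e₂.1⟩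

end BruhatHypercube

namespace BruhatHypercube

/-! ### Length and inversions -/

/-- The inversions of a permutation. -/
def inversions {n : ℕ} (w : Sym n) : Finset (Fin n × Fin n) :=
  {p | p.1 < p.2 ∧ w p.2 < w p.1}

lemma mem_inversions {n : ℕ} {w : Sym n} {p q : Fin n} :
    (p, q) ∈ inversions w ↔ p < q ∧ w q < w p := by
  simp [inversions]

lemma card_inversions_lt_mul_swap {n : ℕ} (w : Sym n) {i j : Fin n} (hij : i < j)
    (hw : w i < w j) : (inversions w).card < (inversions (w * Equiv.swap i j)).card := by
  classical
  set σ := Equiv.swap i j with hσ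
  have hσσ : ∀ a, σ (σ a) = a := fun a => Equiv.swap_apply_self i j a
  have hmem : (i, j) ∈ inversions (w * σ) := by
    simp [mem_inversions, hσ, hij, hw]
  rw [← Finset.card_erase_add_one hmem, Nat.lt_succ_iff]
  refine Finset.card_le_card_of_injOn
    (fun p => if σ p.1 < σ p.2 then (σ p.1, σ p.2) else p) ?_ ?_
  · rintro ⟨p, q⟩ hp
    have hp' : p < q ∧ w q < w p := mem_inversions.1 hp
    simp only [Finset.coe_erase, Set.mem_sdiff, Finset.mem_coe, Set.mem_singleton_iff]
    split_ifs with h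
    · refine ⟨mem_inversions.2 ⟨h, by simpa [hσσ] using hp'.2⟩, fun hc => ?_⟩
      simp only [Prod.mk.injEq] at hc
      have h1 : p = j := by rw [← hσσ p, hc.1, hσ, Equiv.swap_apply_left]
      have h2 : q = i := by rw [← hσσ q, hc.2, hσ, Equiv.swap_apply_right]
      subst h1 h2
      exact absurd hp'.1 hij.not_gt
    · have h' : ¬ σ p < σ q := h
      rw [mem_inversions, Equiv.Perm.mul_apply, Equiv.Perm.mul_apply, Prod.mk.injEq]
      rw [hσ] at h' ⊢
      rw [Equiv.swap_apply_def, Equiv.swap_apply_def] at h' ⊢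
      refine ⟨⟨hp'.1, ?_⟩, ?_⟩
      · split_ifs at h' ⊢ <;> subst_vars <;> omega
      · rintro ⟨rfl, rfl⟩
        exact absurd hp'.2 hw.not_gt
  · rintro ⟨p, q⟩ hp ⟨p', q'⟩ hp' h
    have hp1 := (mem_inversions.1 hp).1
    have hp1' := (mem_inversions.1 hp').1
    dsimp only at h
    split_ifs at h with h1 h2 h2
    · simpa using h
    · rw [Prod.mk.injEq] at h
      rw [← h.1, ← h.2, hσσ, hσσ] at h2
      exact absurd hp1 h2
    · rw [Prod.mk.injEq] at h
      rw [h.1, h.2, hσσ, hσσ] at h1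
      exact absurd hp1' h1
    · exact h

lemma swap_mul_eq_mul_swap {n : ℕ} (w : Sym n) (a b : Fin n) :
    Equiv.swap a b * w = w * Equiv.swap (w⁻¹ a) (w⁻¹ b) := by
  rw [Equiv.mul_swap_eq_swap_mul]; simp

lemma card_inversions_lt_swap_mul {n : ℕ} (w : Sym n) {a b : Fin n} (hab : a < b)
    (hw : w⁻¹ a < w⁻¹ b) : (inversions w).card < (inversions (Equiv.swap a b * w)).card := by
  rw [swap_mul_eq_mul_swap]
  exact card_inversions_lt_mul_swap w hw (by simpa using hab)

lemma card_inversions_swap_mul_lt {n : ℕ} (w : Sym n) {a b : Fin n} (hab : a < b)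
    (hw : w⁻¹ b < w⁻¹ a) : (inversions (Equiv.swap a b * w)).card < (inversions w).card := by
  have := card_inversions_lt_swap_mul (Equiv.swap a b * w) hab (by simpa using hw)
  simpa [← mul_assoc] using this

lemma card_inversions_simple_mul_le {n : ℕ} {s : Sym n} (hs : IsSimple s) (w : Sym n) :
    (inversions (s * w)).card ≤ (inversions w).card + 1 := by
  classical
  obtain ⟨a, b, hab, rfl⟩ := hs
  refine (Finset.card_le_card (t := insert (w⁻¹ a, w⁻¹ b) (inversions w)) ?_).trans
    (Finset.card_insert_le _ _)
  rintro ⟨p, q⟩ hp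
  rw [mem_inversions, Equiv.Perm.mul_apply, Equiv.Perm.mul_apply, Equiv.swap_apply_def,
    Equiv.swap_apply_def] at hp
  rw [Finset.mem_insert, mem_inversions, Prod.mk.injEq, Equiv.Perm.eq_inv_iff_eq,
    Equiv.Perm.eq_inv_iff_eq]
  have hne : w p ≠ w q := fun h => hp.1.ne (w.injective h)
  obtain ⟨h1, h2⟩ := hp
  split_ifs at h2 <;> omega

lemma exists_left_descent {n : ℕ} {w : Sym n} (hw : w ≠ 1) :
    ∃ s, IsSimple s ∧ (inversions (s * w)).card < (inversions w).card := by
  by_contra! hcon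
  apply hw
  have hmono : StrictMono (w⁻¹ : Sym n) := by
    cases n with
    | zero => exact fun a => a.elim0
    | succ n =>
      rw [Fin.strictMono_iff_lt_succ]
      intro i
      by_contra hi
      have hne : (w⁻¹ : Sym (n + 1)) i.castSucc ≠ (w⁻¹ : Sym (n + 1)) i.succ :=
        fun h => i.castSucc_lt_succ.ne ((w⁻¹ : Sym (n + 1)).injective h)
      have := card_inversions_swap_mul_lt w i.castSucc_lt_succ
        (lt_of_le_of_ne (not_lt.1 hi) hne.symm)
      exact absurd (hcon _ ⟨i.castSucc, i.succ, by simp, rfl⟩) this.not_ge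
  have : (w⁻¹ : Sym n) = 1 := by
    ext i
    have := (hmono.range_inj strictMono_id).1
      (by rw [(w⁻¹ : Sym n).surjective.range_eq, Function.surjective_id.range_eq])
    simp [this]
  simpa using this

lemma inversions_one (n : ℕ) : inversions (1 : Sym n) = ∅ := by
  ext ⟨p, q⟩
  simp only [mem_inversions, Equiv.Perm.one_apply, Finset.notMem_empty, iff_false]
  exact fun h => h.1.not_gt h.2

lemma exists_word {n : ℕ} (w : Sym n) : ∃ l : List (Sym n),
    (∀ s ∈ l, IsSimple s) ∧ l.prod = w ∧ l.length ≤ (inversions w).card := by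
  induction hk : (inversions w).card using Nat.strong_induction_on generalizing w with
  | _ k ih =>
    by_cases hw : w = 1
    · exact ⟨[], by simp [hw]⟩
    · obtain ⟨s, hs, hlt⟩ := exists_left_descent hw
      obtain ⟨l, h1, h2, h3⟩ := ih _ (hk ▸ hlt) (s * w) rfl
      refine ⟨s :: l, ?_, ?_, ?_⟩
      · simpa using ⟨hs, h1⟩
      · obtain ⟨a, b, -, rfl⟩ := hs
        simp [h2, ← mul_assoc]
      · simp only [List.length_cons]; omega

/-- The Coxeter length is the number of inversions. -/
lemma length_eq_card_inversions {n : ℕ} (w : Sym n) : length w = (inversions w).card := by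
  apply le_antisymm
  · obtain ⟨l, h1, h2, h3⟩ := exists_word w
    refine le_trans (Nat.sInf_le ?_) h3
    exact ⟨l, h1, h2, rfl⟩
  · obtain ⟨l₀, h1, h2, -⟩ := exists_word w
    refine le_csInf ⟨_, l₀, h1, h2, rfl⟩ ?_
    rintro _ ⟨l, hl, rfl, rfl⟩
    clear h1 h2
    induction l with
    | nil => simp [inversions_one]
    | cons s l ih =>
      rw [List.prod_cons, List.length_cons]
      exact (card_inversions_simple_mul_le (hl s (by simp)) _).trans
        (Nat.succ_le_succ (ih fun t ht => hl t (by simp [ht])))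

lemma length_lt_swap_mul_iff {n : ℕ} (w : Sym n) {a b : Fin n} (hab : a < b) :
    length w < length (Equiv.swap a b * w) ↔ w⁻¹ a < w⁻¹ b := by
  simp only [length_eq_card_inversions]
  refine ⟨fun h => ?_, card_inversions_lt_swap_mul w hab⟩
  by_contra hc
  have hne : w⁻¹ b ≠ w⁻¹ a := fun h => hab.ne' (w⁻¹.injective h)
  exact h.not_gt (card_inversions_swap_mul_lt w hab (lt_of_le_of_ne (not_lt.1 hc) hne))

lemma length_swap_mul_lt_iff {n : ℕ} (w : Sym n) {a b : Fin n} (hab : a < b) :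
    length (Equiv.swap a b * w) < length w ↔ w⁻¹ b < w⁻¹ a := by
  have := length_lt_swap_mul_iff (Equiv.swap a b * w) hab
  simpa [← mul_assoc] using this

lemma length_lt_mul_swap_iff {n : ℕ} (w : Sym n) {i j : Fin n} (hij : i < j) :
    length w < length (w * Equiv.swap i j) ↔ w i < w j := by
  rcases lt_trichotomy (w i) (w j) with h | h | h
  · rw [Equiv.mul_swap_eq_swap_mul, length_lt_swap_mul_iff w h]; simp [hij, h]
  · exact absurd (w.injective h) hij.ne
  · rw [Equiv.mul_swap_eq_swap_mul, Equiv.swap_comm, length_lt_swap_mul_iff w h]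
    simp [hij.not_gt, h.not_gt]

lemma length_mul_swap_lt_iff {n : ℕ} (w : Sym n) {i j : Fin n} (hij : i < j) :
    length (w * Equiv.swap i j) < length w ↔ w j < w i := by
  have := length_lt_mul_swap_iff (w * Equiv.swap i j) hij
  simpa [mul_assoc] using this

lemma length_one (n : ℕ) : length (1 : Sym n) = 0 := by
  simp [length_eq_card_inversions, inversions_one]

lemma IsSimple.mul_self {n : ℕ} {s : Sym n} (hs : IsSimple s) : s * s = 1 := by
  obtain ⟨a, b, -, rfl⟩ := hs
  exact Equiv.swap_mul_self a b

lemma IsSimple.mul_mul_cancel_left {n : ℕ} {s : Sym n} (hs : IsSimple s) (w : Sym n) :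
    s * (s * w) = w := by
  rw [← mul_assoc, hs.mul_self, one_mul]

lemma IsSimple.mul_mul_cancel_right {n : ℕ} {s : Sym n} (hs : IsSimple s) (w : Sym n) :
    w * s * s = w := by
  rw [mul_assoc, hs.mul_self, mul_one]

lemma length_simple_mul_le {n : ℕ} {s : Sym n} (hs : IsSimple s) (w : Sym n) :
    length (s * w) ≤ length w + 1 := by
  simpa only [length_eq_card_inversions] using card_inversions_simple_mul_le hs w

lemma length_eq_of_simple_mul_lt {n : ℕ} {s : Sym n} (hs : IsSimple s) {w : Sym n}
    (h : length (s * w) < length w) : length w = length (s * w) + 1 := by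
  have := length_simple_mul_le hs (s * w)
  rw [hs.mul_mul_cancel_left] at this
  omega

lemma length_inv {n : ℕ} (w : Sym n) : length w⁻¹ = length w := by
  have key : ∀ w : Sym n, length w⁻¹ ≤ length w := by
    intro w
    simp only [length_eq_card_inversions]
    refine Finset.card_le_card_of_injOn (fun p => (w⁻¹ p.2, w⁻¹ p.1)) ?_ ?_
    · rintro ⟨p, q⟩ hp
      have := mem_inversions.1 hp
      simp only [Finset.mem_coe, mem_inversions]
      simpa using ⟨this.2, this.1⟩
    · rintro ⟨p, q⟩ - ⟨p', q'⟩ - h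
      simp only [Prod.mk.injEq, EmbeddingLike.apply_eq_iff_eq] at h
      exact Prod.ext h.2 h.1
  exact le_antisymm (key w) (by simpa using key w⁻¹)

lemma IsSimple.inv_eq {n : ℕ} {s : Sym n} (hs : IsSimple s) : s⁻¹ = s :=
  inv_eq_of_mul_eq_one_left hs.mul_self

lemma length_mul_simple_le {n : ℕ} {s : Sym n} (hs : IsSimple s) (w : Sym n) :
    length (w * s) ≤ length w + 1 := by
  rw [← length_inv (w * s), ← length_inv w, mul_inv_rev, hs.inv_eq]
  exact length_simple_mul_le hs _

lemma exists_right_descent {n : ℕ} {w : Sym n} (hw : w ≠ 1) :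
    ∃ s, IsSimple s ∧ length (w * s) < length w := by
  obtain ⟨s, hs, h⟩ := exists_left_descent (inv_ne_one.2 hw)
  refine ⟨s, hs, ?_⟩
  rw [← length_inv (w * s), ← length_inv w, mul_inv_rev, hs.inv_eq]
  simpa only [length_eq_card_inversions] using h

/-! ### Increasing paths and Dyer's formula -/

/-- The vector whose entry at `u` is the generating function, by length, of the paths from `u` to
`v` in the Bruhat graph whose labels, read from the end of the path, form a sublist of `L`. -/
noncomputable def pathGF {n : ℕ} : List (Reflection n) → Sym n → (Sym n → ℤ[X])
  | [], v => Pi.single v 1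
  | t :: L, v => pathGF L v +
      if length (t.1 * v) < length v then (X : ℤ[X]) • pathGF L (t.1 * v) else 0

/-- The operator `[y] ↦ [s y] + X [y]` if `s y > y`, `[y] ↦ [s y]` otherwise. -/
noncomputable def leftOp {n : ℕ} (s : Sym n) : (Sym n → ℤ[X]) →ₗ[ℤ[X]] (Sym n → ℤ[X]) where
  toFun f u := f (s * u) + if length u < length (s * u) then X * f u else 0
  map_add' f g := by
    ext1 u; simp only [Pi.add_apply]; split_ifs <;> ring
  map_smul' c f := by
    ext1 u; simp only [Pi.smul_apply, smul_eq_mul, RingHom.id_apply]; split_ifs <;> ring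

/-- The operator `[y] ↦ [y s] + X [y]` if `y s > y`, `[y] ↦ [y s]` otherwise. -/
noncomputable def rightOp {n : ℕ} (s : Sym n) : (Sym n → ℤ[X]) →ₗ[ℤ[X]] (Sym n → ℤ[X]) where
  toFun f u := f (u * s) + if length u < length (u * s) then X * f u else 0
  map_add' f g := by
    ext1 u; simp only [Pi.add_apply]; split_ifs <;> ring
  map_smul' c f := by
    ext1 u; simp only [Pi.smul_apply, smul_eq_mul, RingHom.id_apply]; split_ifs <;> ring

lemma leftOp_apply {n : ℕ} (s : Sym n) (f : Sym n → ℤ[X]) (u : Sym n) :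
    leftOp s f u = f (s * u) + if length u < length (s * u) then X * f u else 0 := rfl

lemma rightOp_apply {n : ℕ} (s : Sym n) (f : Sym n → ℤ[X]) (u : Sym n) :
    rightOp s f u = f (u * s) + if length u < length (u * s) then X * f u else 0 := rfl

lemma length_lt_left_iff_of_ne {n : ℕ} {s r : Sym n} (hs : IsSimple s) (hr : IsSimple r)
    {u : Sym n} (h : s * u ≠ u * r) :
    length (u * r) < length (s * (u * r)) ↔ length u < length (s * u) := by
  obtain ⟨a, b, hab, rfl⟩ := hs
  obtain ⟨i, j, hij, rfl⟩ := hr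
  have hab' : a < b := by omega
  rw [length_lt_swap_mul_iff _ hab', length_lt_swap_mul_iff _ hab', mul_inv_rev,
    Equiv.swap_inv, Equiv.Perm.mul_apply, Equiv.Perm.mul_apply]
  have hne : u⁻¹ a ≠ u⁻¹ b := fun h => hab'.ne (u⁻¹.injective h)
  rw [swap_mul_eq_mul_swap] at h
  generalize u⁻¹ a = p at *
  generalize u⁻¹ b = q at *
  have h1 : ¬ (p = i ∧ q = j) := by rintro ⟨rfl, rfl⟩; exact h rfl
  have h2 : ¬ (p = j ∧ q = i) := by rintro ⟨rfl, rfl⟩; exact h (by rw [Equiv.swap_comm])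
  rw [Equiv.swap_apply_def, Equiv.swap_apply_def]
  split_ifs <;> omega

lemma length_lt_right_iff_of_ne {n : ℕ} {s r : Sym n} (hs : IsSimple s) (hr : IsSimple r)
    {u : Sym n} (h : s * u ≠ u * r) :
    length (s * u) < length (s * u * r) ↔ length u < length (u * r) := by
  have h' : r * u⁻¹ ≠ u⁻¹ * s := by
    intro hc
    apply h
    rw [← inv_inj, mul_inv_rev, mul_inv_rev, hs.inv_eq, hr.inv_eq, hc]
  have := length_lt_left_iff_of_ne hr hs h'
  rw [← length_inv (u⁻¹ * s), ← length_inv (r * (u⁻¹ * s)), ← length_inv (r * u⁻¹),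
    length_inv u] at this
  simpa [hs.inv_eq, hr.inv_eq, mul_assoc] using this

lemma leftOp_rightOp_comm {n : ℕ} {s r : Sym n} (hs : IsSimple s) (hr : IsSimple r)
    (f : Sym n → ℤ[X]) : leftOp s (rightOp r f) = rightOp r (leftOp s f) := by
  ext1 u
  simp only [leftOp_apply, rightOp_apply]
  by_cases h : s * u = u * r
  · have e : s * (u * r) = u := by rw [← h, hs.mul_mul_cancel_left]
    simp only [mul_assoc, h, e, hr.mul_self, mul_one]
  · simp only [length_lt_right_iff_of_ne hs hr h, length_lt_left_iff_of_ne hs hr h]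
    simp only [mul_assoc]
    split_ifs <;> ring

lemma leftOp_single {n : ℕ} {s : Sym n} (hs : IsSimple s) (y : Sym n) :
    leftOp s (Pi.single (s * y) 1) =
      Pi.single y 1 +
        if length (s * y) < length y then (X : ℤ[X]) • Pi.single (s * y) 1 else 0 := by
  ext1 u
  simp only [leftOp_apply, Pi.add_apply, Pi.single_apply, mul_right_inj]
  congr 1
  by_cases h : u = s * y
  · subst h
    rw [hs.mul_mul_cancel_left]
    split_ifs <;> simp_all
  · split_ifs <;> simp [h]

lemma rightOp_single_of_lt {n : ℕ} {s : Sym n} (hs : IsSimple s) {y : Sym n}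
    (hy : length (y * s) < length y) :
    rightOp s (Pi.single y 1) = Pi.single (y * s) 1 := by
  ext1 u
  simp only [rightOp_apply, Pi.single_apply]
  have e : u * s = y ↔ u = y * s := by
    constructor
    · rintro rfl; rw [hs.mul_mul_cancel_right]
    · rintro rfl; rw [hs.mul_mul_cancel_right]
  simp only [e]
  by_cases h : u = y
  · subst h
    rw [if_neg hy.not_gt, add_zero]
  · simp [h]

lemma exists_eq_transposition {n : ℕ} (t : Reflection n) :
    ∃ (a b : Fin n) (h : a < b), t = transposition a b h := by
  obtain ⟨t, a, b, hab, rfl⟩ := t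
  rcases lt_or_gt_of_ne hab with h | h
  · exact ⟨a, b, h, rfl⟩
  · exact ⟨b, a, h, Subtype.ext (Equiv.swap_comm a b)⟩

lemma transposition_inj {n : ℕ} {a b c d : Fin n} {h : a < b} {h' : c < d} :
    transposition a b h = transposition c d h' ↔ a = c ∧ b = d := by
  constructor
  · intro e
    have e' : Equiv.swap a b = Equiv.swap c d := congrArg Subtype.val e
    have h1 : b = Equiv.swap c d a := by rw [← e', Equiv.swap_apply_left]
    have h2 : a = Equiv.swap c d b := by rw [← e', Equiv.swap_apply_right]
    rw [Equiv.swap_apply_def] at h1 h2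
    split_ifs at h1 h2 <;> omega
  · rintro ⟨rfl, rfl⟩; rfl

/-- If the inversions of `w` are the reflections before `(a b)` in a reflection order, then `w`
takes consecutive values at `a` and `b`. -/
lemma consecutive_of_inversions {n : ℕ} {r : Reflection n → Reflection n → Prop}
    (hr : IsReflectionOrder r) {a b : Fin n} (hab : a < b) {w : Sym n}
    (hw : ∀ i j (h : i < j), w j < w i ↔ r (transposition i j h) (transposition a b hab)) :
    (w b : ℕ) = w a + 1 := by
  have := hr.1
  have hlt : w a < w b := by
    rcases lt_trichotomy (w a) (w b) with h | h | h
    · exact h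
    · exact absurd (w.injective h) hab.ne
    · exact absurd ((hw a b hab).1 h) (irrefl_of r _)
  by_contra hne
  obtain ⟨c, hc⟩ := w.surjective ⟨w a + 1, by omega⟩
  have h1 : w a < w c := by rw [hc, Fin.lt_def]; simp
  have h2 : w c < w b := by
    rw [hc, Fin.lt_def]; simp only; rw [Fin.lt_def] at hlt; omega
  have hca : c ≠ a := by rintro rfl; exact h1.false
  have hcb : c ≠ b := by rintro rfl; exact h2.false
  rcases lt_or_gt_of_ne hca with h | h
  · have e1 := (hw c a h).1 h1
    have e2 := mt (hw c b (h.trans hab)).2 h2.not_gt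
    rcases hr.2 c a b h hab with ⟨_, e⟩ | ⟨e, e'⟩
    · exact e2 e
    · exact irrefl_of r _ (trans_of r e1 (trans_of r e e'))
  rcases lt_or_gt_of_ne hcb with h' | h'
  · have e1 := mt (hw a c h).2 h1.not_gt
    have e2 := mt (hw c b h').2 h2.not_gt
    rcases hr.2 a c b h h' with ⟨e, e'⟩ | ⟨e, e'⟩
    · exact e1 e
    · exact e2 e
  · have e1 := (hw b c h').1 h2
    have e2 := mt (hw a c h).2 h1.not_gt
    rcases hr.2 a b c hab h' with ⟨e, e'⟩ | ⟨e, e'⟩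
    · exact irrefl_of r _ (trans_of r (trans_of r e e') e1)
    · exact e2 e'

lemma exists_pathGF_eq {n : ℕ} {r : Reflection n → Reflection n → Prop}
    (hr : IsReflectionOrder r) (L : List (Reflection n)) (hL : L.Pairwise fun a b => r b a)
    (hclosed : ∀ t ∈ L, ∀ t', r t' t → t' ∈ L) :
    ∃ (w : Sym n) (G : (Sym n → ℤ[X]) →ₗ[ℤ[X]] (Sym n → ℤ[X])),
      (∀ i j (h : i < j), w j < w i ↔ transposition i j h ∈ L) ∧
      (∀ s, IsSimple s → ∀ f, G (rightOp s f) = rightOp s (G f)) ∧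
      ∀ y, pathGF L y = G (Pi.single (w * y) 1) := by
  have := hr.1
  induction L with
  | nil =>
    refine ⟨1, LinearMap.id, fun i j h => ?_, fun _ _ _ => rfl, fun y => by simp [pathGF]⟩
    simpa using h.le
  | cons t L ih =>
    rw [List.pairwise_cons] at hL
    have hmem : ∀ t', t' ∈ L ↔ r t' t := by
      refine fun t' => ⟨hL.1 t', fun h => ?_⟩
      rcases List.mem_cons.1 (hclosed t (by simp) t' h) with rfl | h'
      · exact absurd h (irrefl_of r _)
      · exact h'
    obtain ⟨w, G, h1, h2, h3⟩ := ih hL.2 fun t' ht' t'' ht'' =>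
      (hmem t'').2 (trans_of r ht'' ((hmem t').1 ht'))
    obtain ⟨a, b, hab, rfl⟩ := exists_eq_transposition t
    have hcons := consecutive_of_inversions hr hab fun i j h => (h1 i j h).trans (hmem _)
    have hlt : w a < w b := by rw [Fin.lt_def]; omega
    set s : Sym n := Equiv.swap (w a) (w b) with hs
    have hsimple : IsSimple s := ⟨w a, w b, hcons, rfl⟩
    refine ⟨s * w, G ∘ₗ leftOp s, fun i j h => ?_, fun ρ hρ f => ?_, fun y => ?_⟩
    · rw [List.mem_cons, transposition_inj, ← h1, Equiv.Perm.mul_apply, Equiv.Perm.mul_apply,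
        hs, Equiv.swap_apply_def, Equiv.swap_apply_def]
      have hwij : w i ≠ w j := fun e => h.ne (w.injective e)
      simp only [EmbeddingLike.apply_eq_iff_eq]
      have inj : ∀ p q, (w p : ℕ) = w q → p = q := fun p q e => w.injective (Fin.ext e)
      have := inj i a
      have := inj i b
      have := inj j a
      have := inj j b
      split_ifs <;> subst_vars <;> omega
    · rw [LinearMap.comp_apply, LinearMap.comp_apply, leftOp_rightOp_comm hsimple hρ, h2 ρ hρ]
    · have e : w * (Equiv.swap a b * y) = s * (w * y) := by
        rw [← mul_assoc, ← mul_assoc, Equiv.mul_swap_eq_swap_mul]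
      have hiff : length (s * (w * y)) < length (w * y) ↔
          length (Equiv.swap a b * y) < length y := by
        rw [hs, length_swap_mul_lt_iff _ hlt, length_swap_mul_lt_iff _ hab]; simp
      rw [LinearMap.comp_apply, mul_assoc, leftOp_single hsimple, map_add]
      simp only [pathGF, h3, transposition, hiff, e]
      split_ifs <;> simp

/-- A list of all reflections that is decreasing for `r`. -/
def IsListing {n : ℕ} (r : Reflection n → Reflection n → Prop) (L : List (Reflection n)) : Prop :=
  L.Pairwise (fun a b => r b a) ∧ ∀ t, t ∈ L

lemma pathGF_one {n : ℕ} (L : List (Reflection n)) :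
    pathGF L (1 : Sym n) = Pi.single 1 1 := by
  induction L with
  | nil => rfl
  | cons t L ih => simp [pathGF, ih, length_one]

lemma pathGF_mul_simple {n : ℕ} {r : Reflection n → Reflection n → Prop}
    (hr : IsReflectionOrder r) {L : List (Reflection n)} (hL : IsListing r L)
    {s : Sym n} (hs : IsSimple s) {v : Sym n} (hv : length v < length (v * s)) :
    pathGF L (v * s) = rightOp s (pathGF L v) := by
  obtain ⟨w, G, h1, h2, h3⟩ := exists_pathGF_eq hr L hL.1 fun _ _ t' _ => hL.2 t'
  rw [h3, h3, ← h2 s hs, rightOp_single_of_lt hs, mul_assoc]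
  obtain ⟨i, j, hij, rfl⟩ := hs
  have hij' : i < j := by rw [Fin.lt_def]; omega
  rw [length_lt_mul_swap_iff _ hij'] at hv
  rw [length_mul_swap_lt_iff _ hij']
  exact (h1 _ _ hv).2 (hL.2 _)

lemma pathGF_simple_mul {n : ℕ} {r : Reflection n → Reflection n → Prop}
    (hr : IsReflectionOrder r) {L : List (Reflection n)} (hL : IsListing r L)
    {s : Sym n} (hs : IsSimple s) {v : Sym n} (hv : length v < length (s * v)) :
    pathGF L (s * v) = leftOp s (pathGF L v) := by
  induction hk : length v using Nat.strong_induction_on generalizing v with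
  | _ k ih =>
    by_cases h1 : v = 1
    · subst h1
      have := pathGF_mul_simple hr hL hs (v := 1) (by simpa using hv)
      rw [mul_one, ← one_mul s, this, pathGF_one, one_mul]
      ext1 u
      have e : u * s = 1 ↔ s * u = 1 := mul_eq_one_comm
      simp only [leftOp_apply, rightOp_apply, Pi.single_apply, e]
      by_cases hu : u = 1
      · subst hu; simp
      · simp [hu]
    · obtain ⟨ρ, hρ, hlt⟩ := exists_right_descent h1
      set v' := v * ρ with hv'
      have e : v = v' * ρ := by rw [hv', hρ.mul_mul_cancel_right]
      have l1 : length (s * v') ≤ length v' + 1 := length_simple_mul_le hs v'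
      have l2 : length (s * v) ≤ length (s * v') + 1 := by
        rw [e, ← mul_assoc]; exact length_mul_simple_le hρ _
      have l3 : length v ≤ length v' + 1 := by
        conv_lhs => rw [e]
        exact length_mul_simple_le hρ _
      have l4 := ih _ (hk ▸ hlt) (v := v') (by omega) rfl
      have l5 := pathGF_mul_simple hr hL hρ (v := v') (by rw [← e]; omega)
      have l6 := pathGF_mul_simple hr hL hρ (v := s * v') (by rw [mul_assoc, ← e]; omega)
      rw [e, ← mul_assoc, l6, l4, l5, leftOp_rightOp_comm hs hρ]

lemma Edge.le {n : ℕ} {x y : Sym n} (h : Edge x y) : BruhatLE x y :=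
  Relation.ReflTransGen.single h

lemma BruhatLE.trans {n : ℕ} {x y z : Sym n} (h : BruhatLE x y) (h' : BruhatLE y z) :
    BruhatLE x z :=
  Relation.ReflTransGen.trans h h'

lemma BruhatLE.eq_or_length_lt {n : ℕ} {x y : Sym n} (h : BruhatLE x y) :
    x = y ∨ length x < length y := by
  induction h with
  | refl => exact Or.inl rfl
  | tail _ h ih =>
    right
    rcases ih with rfl | ih
    · exact h.2
    · exact ih.trans h.2

lemma edge_mul {n : ℕ} (t : Reflection n) {v : Sym n} (h : length (t.1 * v) < length v) :
    Edge (t.1 * v) v := by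
  refine ⟨?_, h⟩
  have : v * (t.1 * v)⁻¹ = t.1 := by
    obtain ⟨t, a, b, hab, rfl⟩ := t
    simp
  rw [this]
  exact t.2

lemma pathGF_eq_zero {n : ℕ} (L : List (Reflection n)) {u v : Sym n} (h : ¬ BruhatLE u v) :
    pathGF L v u = 0 := by
  induction L generalizing v with
  | nil =>
    have : u ≠ v := by rintro rfl; exact h Relation.ReflTransGen.refl
    simp [pathGF, this]
  | cons t L ih =>
    rw [pathGF, Pi.add_apply, ih h, zero_add]
    split_ifs with hlt
    · rw [Pi.smul_apply, ih fun hc => h (hc.trans (edge_mul t hlt).le), smul_zero]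
    · rfl

lemma pathGF_self {n : ℕ} (L : List (Reflection n)) (v : Sym n) : pathGF L v v = 1 := by
  induction L generalizing v with
  | nil => simp [pathGF]
  | cons t L ih =>
    rw [pathGF, Pi.add_apply, ih, add_eq_left]
    split_ifs with hlt
    · rw [Pi.smul_apply, pathGF_eq_zero, smul_zero]
      intro hc
      rcases hc.eq_or_length_lt with h | h
      · rw [← h] at hlt; exact hlt.false
      · omega
    · rfl

lemma BruhatLE.refl {n : ℕ} (x : Sym n) : BruhatLE x x := Relation.ReflTransGen.refl

lemma isRTilde_pathGF {n : ℕ} {r : Reflection n → Reflection n → Prop}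
    (hr : IsReflectionOrder r) {L : List (Reflection n)} (hL : IsListing r L) (u v : Sym n) :
    IsRTilde u v (pathGF L v u) := by
  induction hk : length v using Nat.strong_induction_on generalizing u v with
  | _ k ih =>
    unfold IsRTilde
    rw [RPoly]
    split_ifs with h1 h2 h3 h4
    · subst h2; simp [pathGF_self]
    · obtain ⟨hs, hlt⟩ := h3.choose_spec
      set s := h3.choose
      have hrec := pathGF_simple_mul hr hL hs (v := s * v) (by rwa [hs.mul_mul_cancel_left])
      rw [hs.mul_mul_cancel_left] at hrec
      have ih1 := ih _ (hk ▸ hlt) (s * u) (s * v) rfl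
      unfold IsRTilde at ih1
      rw [ih1, hrec, leftOp_apply, if_neg h4.not_gt, add_zero,
        length_eq_of_simple_mul_lt hs hlt, length_eq_of_simple_mul_lt hs h4]
      push_cast
      ring_nf
    · obtain ⟨hs, hlt⟩ := h3.choose_spec
      set s := h3.choose
      have hrec := pathGF_simple_mul hr hL hs (v := s * v) (by rwa [hs.mul_mul_cancel_left])
      rw [hs.mul_mul_cancel_left] at hrec
      have hne : length u ≠ length (s * u) := by
        obtain ⟨a, b, hab, hsab⟩ := hs
        have hab' : a < b := by rw [Fin.lt_def]; omega
        rw [hsab]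
        intro hc
        have e1 := mt (length_lt_swap_mul_iff u hab').2 (by omega)
        have e2 := mt (length_swap_mul_lt_iff u hab').2 (by omega)
        exact hab'.ne (u⁻¹.injective (le_antisymm (not_lt.1 e2) (not_lt.1 e1)))
      have hu : length u < length (s * u) := by omega
      have hu' : length (s * u) = length u + 1 := by
        have := length_eq_of_simple_mul_lt hs (w := s * u) (by rwa [hs.mul_mul_cancel_left])
        rwa [hs.mul_mul_cancel_left] at this
      have ih1 := ih _ (hk ▸ hlt) (s * u) (s * v) rfl
      have ih2 := ih _ (hk ▸ hlt) u (s * v) rfl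
      unfold IsRTilde at ih1 ih2
      have hv' := length_eq_of_simple_mul_lt hs hlt
      rw [map_add, map_mul, map_mul, ih1, ih2, hrec, leftOp_apply, if_pos hu, map_add, map_mul,
        map_sub, aeval_X, aeval_X, map_one, hu', hv']
      push_cast
      set A := aeval (LaurentPolynomial.T 1 - LaurentPolynomial.T (-1) : LaurentPolynomial ℤ)
        (pathGF L (s * v) u)
      set B := aeval (LaurentPolynomial.T 1 - LaurentPolynomial.T (-1) : LaurentPolynomial ℤ)
        (pathGF L (s * v) (s * u))
      set d : ℤ := (length (s * v) : ℤ) - length u with hd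
      have e1 : (length (s * v) : ℤ) - (length u + 1) = d + (-1) := by rw [hd]; ring
      have e2 : (length (s * v) : ℤ) + 1 - length u = d + 1 := by rw [hd]; ring
      have e3 : (2 : ℤ) = 1 + 1 := by norm_num
      have e4 : (LaurentPolynomial.T 1 * LaurentPolynomial.T (-1) : LaurentPolynomial ℤ) = 1 := by
        rw [← LaurentPolynomial.T_add]; simp
      rw [e1, e2, e3, LaurentPolynomial.T_add, LaurentPolynomial.T_add, LaurentPolynomial.T_add]
      linear_combination
        (LaurentPolynomial.T d * B * LaurentPolynomial.T 1 + LaurentPolynomial.T d * A) * e4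
    · exfalso
      apply h3
      have hv : v ≠ 1 := by
        rintro rfl
        rcases h1.eq_or_length_lt with h | h
        · exact h2 h
        · rw [length_one] at h; omega
      obtain ⟨s, hs, hlt⟩ := exists_left_descent hv
      exact ⟨s, hs, by simpa only [length_eq_card_inversions] using hlt⟩
    · rw [pathGF_eq_zero L h1]; simp

lemma aeval_T_sub_injective :
    Function.Injective (aeval (R := ℤ)
      (LaurentPolynomial.T 1 - LaurentPolynomial.T (-1) : LaurentPolynomial ℤ)) := by
  rw [injective_iff_map_eq_zero]
  intro P hP
  have hmap : P.map (Int.castRingHom ℚ) = 0 := by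
    refine Polynomial.eq_zero_of_infinite_isRoot _
      (Set.infinite_of_injective_forall_mem
        (f := fun m : ℕ => ((m : ℚ) + 1) - ((m : ℚ) + 1)⁻¹) ?_ ?_)
    · apply StrictMono.injective
      apply strictMono_nat_of_lt_succ
      intro m
      push_cast
      have : ((m : ℚ) + 1 + 1)⁻¹ < ((m : ℚ) + 1)⁻¹ := by
        apply inv_strictAnti₀ <;> linarith [(Nat.cast_nonneg m : (0 : ℚ) ≤ m)]
      linarith
    · intro m
      have hm : (m : ℚ) + 1 ≠ 0 := by positivity
      set z : ℚˣ := Units.mk0 _ hm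
      have h := congrArg (LaurentPolynomial.eval₂ (Int.castRingHom ℚ) z) hP
      rw [map_zero, aeval_def, hom_eval₂] at h
      rw [RingHom.ext_int ((LaurentPolynomial.eval₂ (Int.castRingHom ℚ) z).comp _)
        (Int.castRingHom ℚ), ← eval_map] at h
      simpa [z, IsRoot.def] using h
  exact (Polynomial.map_eq_zero_iff (RingHom.injective_int _)).1 hmap

/-- Dyer's formula: `R̃_{u,v}` is the generating function of the increasing paths. -/
lemma rTilde_eq_pathGF {n : ℕ} {r : Reflection n → Reflection n → Prop}
    (hr : IsReflectionOrder r) {L : List (Reflection n)} (hL : IsListing r L) (u v : Sym n) :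
    RTilde u v = pathGF L v u := by
  have h1 := isRTilde_pathGF hr hL u v
  have h2 : IsRTilde u v (RTilde u v) := Classical.epsilon_spec (p := IsRTilde u v) ⟨_, h1⟩
  unfold IsRTilde at h1 h2
  rw [h1] at h2
  refine (aeval_T_sub_injective (mul_left_cancel₀ ?_ h2)).symm
  exact (LaurentPolynomial.isUnit_T _).ne_zero

lemma IsReflectionOrder.flip {n : ℕ} {r : Reflection n → Reflection n → Prop}
    (hr : IsReflectionOrder r) : IsReflectionOrder fun a b => r b a := by
  have := hr.1
  refine ⟨inferInstanceAs (IsStrictTotalOrder _ (Function.swap r)), fun a b c hab hbc => ?_⟩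
  rcases hr.2 a b c hab hbc with h | h
  · exact Or.inr h.symm
  · exact Or.inl h.symm

lemma IsReflectionOrder.exists_isListing {n : ℕ} {r : Reflection n → Reflection n → Prop}
    (hr : IsReflectionOrder r) : ∃ L, IsListing r L := by
  classical
  have := hr.1
  let : LinearOrder (Reflection n) := linearOrderOfSTO r
  refine ⟨(Finset.univ : Finset (Reflection n)).sort (· ≥ ·), ?_, by simp⟩
  exact (Finset.sortedGT_sort (Finset.univ : Finset (Reflection n))).pairwise

lemma IsListing.reverse {n : ℕ} {r : Reflection n → Reflection n → Prop}
    {L : List (Reflection n)} (hL : IsListing r L) : IsListing (fun a b => r b a) L.reverse :=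
  ⟨by simpa [List.pairwise_reverse] using hL.1, by simpa using hL.2⟩

/-! ### Composition and inversion of path generating functions -/

/-- The vectors `pathGF L v`, as columns of a matrix. -/
noncomputable def pathMatrix {n : ℕ} (L : List (Reflection n)) :
    Matrix (Sym n) (Sym n) ℤ[X] :=
  Matrix.of fun u v => pathGF L v u

/-- The matrix of the Bruhat graph edges labeled by `t`. -/
noncomputable def edgeMatrix {n : ℕ} (t : Reflection n) : Matrix (Sym n) (Sym n) ℤ[X] :=
  Matrix.of fun u v => if u = t.1 * v ∧ length (t.1 * v) < length v then 1 else 0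

lemma Reflection.mul_self {n : ℕ} (t : Reflection n) : t.1 * t.1 = 1 := by
  obtain ⟨t, a, b, hab, rfl⟩ := t
  exact Equiv.swap_mul_self a b

lemma Reflection.mul_mul_cancel {n : ℕ} (t : Reflection n) (x : Sym n) : t.1 * (t.1 * x) = x := by
  rw [← mul_assoc, t.mul_self, one_mul]

lemma pathMatrix_nil {n : ℕ} : pathMatrix ([] : List (Reflection n)) = 1 := by
  ext1 u v
  simp [pathMatrix, pathGF, Matrix.one_apply, Pi.single_apply]

lemma pathMatrix_cons {n : ℕ} (t : Reflection n) (L : List (Reflection n)) :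
    pathMatrix (t :: L) = pathMatrix L * (1 + (X : ℤ[X]) • edgeMatrix t) := by
  ext1 u v
  rw [mul_add, mul_one, Matrix.add_apply, mul_smul_comm, Matrix.smul_apply, Matrix.mul_apply]
  simp only [pathMatrix, Matrix.of_apply, pathGF, Pi.add_apply, edgeMatrix]
  congr 1
  by_cases h : length (t.1 * v) < length v <;> simp [h]

lemma pathMatrix_append {n : ℕ} (L L' : List (Reflection n)) :
    pathMatrix (L ++ L') = pathMatrix L' * pathMatrix L := by
  induction L with
  | nil => simp [pathMatrix_nil]
  | cons t L ih => rw [List.cons_append, pathMatrix_cons, ih, pathMatrix_cons, mul_assoc]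

lemma edgeMatrix_mul_self {n : ℕ} (t : Reflection n) : edgeMatrix t * edgeMatrix t = 0 := by
  ext1 u v
  rw [Matrix.mul_apply, Matrix.zero_apply]
  refine Finset.sum_eq_zero fun y _ => ?_
  simp only [edgeMatrix, Matrix.of_apply]
  split_ifs with h1 h2
  · obtain ⟨rfl, h2⟩ := h2
    rw [t.mul_mul_cancel] at h1
    exact absurd h1.2 h2.not_gt
  all_goals simp

/-- Substituting `-X` for `X` in all entries. -/
noncomputable def negX {n : ℕ} :
    Matrix (Sym n) (Sym n) ℤ[X] →+* Matrix (Sym n) (Sym n) ℤ[X] :=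
  (compRingHom (-X : ℤ[X])).mapMatrix

lemma negX_one_add {n : ℕ} (t : Reflection n) :
    negX (1 + (X : ℤ[X]) • edgeMatrix t) = 1 - (X : ℤ[X]) • edgeMatrix t := by
  rw [map_add, map_one, sub_eq_add_neg]
  congr 1
  ext1 u v
  simp only [negX, RingHom.mapMatrix_apply, Matrix.map_apply, Matrix.smul_apply, edgeMatrix,
    Matrix.of_apply, coe_compRingHom_apply, Matrix.neg_apply]
  split_ifs <;> simp

lemma negX_pathMatrix_reverse_mul {n : ℕ} (L : List (Reflection n)) :
    negX (pathMatrix L.reverse) * pathMatrix L = 1 := by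
  induction L with
  | nil => simp [pathMatrix_nil]
  | cons t L ih =>
    rw [List.reverse_cons, pathMatrix_append, pathMatrix_cons, pathMatrix_cons, pathMatrix_nil,
      one_mul, map_mul, negX_one_add, mul_assoc, ← mul_assoc (negX _), ih, one_mul]
    rw [sub_mul, mul_add, mul_add, smul_mul_smul_comm, edgeMatrix_mul_self]
    simp

lemma pathGF_eq_pathGF_filter {n : ℕ} (L : List (Reflection n)) (p : Reflection n → Bool)
    {x y : Sym n}
    (h : ∀ (t : Reflection n) (z : Sym n), BruhatLE z y → length (t.1 * z) < length z →
      BruhatLE x (t.1 * z) → p t) :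
    pathGF L y x = pathGF (L.filter p) y x := by
  induction L generalizing y with
  | nil => rfl
  | cons t L ih =>
    have ih' : length (t.1 * y) < length y →
        pathGF L (t.1 * y) x = pathGF (L.filter p) (t.1 * y) x := fun hlt =>
      ih fun t' z hz => h t' z (hz.trans (edge_mul t hlt).le)
    by_cases hp : p t
    · rw [List.filter_cons_of_pos hp, pathGF, pathGF, Pi.add_apply, Pi.add_apply, ih h]
      congr 1
      split_ifs with hlt
      · rw [Pi.smul_apply, Pi.smul_apply, ih' hlt]
      · rfl
    · rw [List.filter_cons_of_neg hp, pathGF, Pi.add_apply, ih h, add_eq_left]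
      split_ifs with hlt
      · rw [Pi.smul_apply, pathGF_eq_zero, smul_zero]
        exact fun hc => hp (h t y (BruhatLE.refl y) hlt hc)
      · rfl

/-- The reflections preceding the labels of all edges from `I ∩ [x,v]` to `[x,v] ∖ I`. -/
def IsSmall {n : ℕ} (r : Reflection n → Reflection n → Prop) (v : Sym n) (I : Finset (Sym n))
    (x : Sym n) (t : Reflection n) : Prop :=
  ∀ (z y : Sym n) (e : Edge z y), z ∈ I → InInterval x v z → y ∉ I → InInterval x v y →
    r t ⟨y * z⁻¹, e.1⟩

lemma IsSmall.of_lt {n : ℕ} {r : Reflection n → Reflection n → Prop} [IsStrictTotalOrder _ r]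
    {v : Sym n} {I : Finset (Sym n)} {x : Sym n} {t t' : Reflection n} (h : IsSmall r v I x t)
    (h' : r t' t) : IsSmall r v I x t' :=
  fun z y e h1 h2 h3 h4 => trans_of r h' (h z y e h1 h2 h3 h4)

lemma label_mul {n : ℕ} (t : Reflection n) (z : Sym n) : (t.1 * z) * z⁻¹ = t.1 := by group

lemma label_mul' {n : ℕ} (t : Reflection n) (z : Sym n) : z * (t.1 * z)⁻¹ = t.1 := by
  have := label_mul t (t.1 * z)
  rwa [t.mul_mul_cancel] at this

lemma IsSmall.not_of_leaving {n : ℕ} {r : Reflection n → Reflection n → Prop}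
    [IsStrictTotalOrder _ r] {v : Sym n} {I : Finset (Sym n)} {x : Sym n} {t : Reflection n}
    {y : Sym n} (hlt : length (t.1 * y) < length y)
    (h1 : t.1 * y ∈ I) (h2 : InInterval x v (t.1 * y)) (h3 : y ∉ I) (h4 : InInterval x v y) :
    ¬ IsSmall r v I x t := by
  intro h
  have := h _ _ (edge_mul t hlt) h1 h2 h3 h4
  simp only [label_mul'] at this
  exact irrefl_of r _ this

lemma filter_append_filter_of_pairwise {α : Type*} {r : α → α → Prop} (p : α → Bool)
    (hp : ∀ a b, r b a → p a → p b) (L : List α) (hL : L.Pairwise fun a b => r b a) :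
    L = L.filter (fun a => !p a) ++ L.filter p := by
  induction L with
  | nil => rfl
  | cons a L ih =>
    rw [List.pairwise_cons] at hL
    by_cases h : p a
    · have hall : ∀ b ∈ a :: L, p b := by
        intro b hb
        rcases List.mem_cons.1 hb with rfl | hb
        · exact h
        · exact hp a b (hL.1 b hb) h
      rw [List.filter_eq_self.2 hall, List.filter_eq_nil_iff.2 (by simpa using hall),
        List.nil_append]
    · rw [List.filter_cons_of_pos (by simpa using h), List.filter_cons_of_neg h, List.cons_append,
        ← ih hL.2]

lemma mem_of_pathGF_ne_zero {n : ℕ} {r : Reflection n → Reflection n → Prop}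
    [IsStrictTotalOrder _ r] {v : Sym n} {I : Finset (Sym n)} {x : Sym n} (hx : x ∈ I)
    (L : List (Reflection n)) (hL : ∀ t ∈ L, IsSmall r v I x t) {y : Sym n} (hy : BruhatLE y v)
    (hne : pathGF L y x ≠ 0) : y ∈ I := by
  induction L generalizing y with
  | nil =>
    by_contra hc
    have : x ≠ y := by rintro rfl; exact hc hx
    simp [pathGF, this] at hne
  | cons t L ih =>
    have hL' : ∀ t ∈ L, IsSmall r v I x t := fun t ht => hL t (by simp [ht])
    by_cases h0 : pathGF L y x = 0
    · rw [pathGF, Pi.add_apply, h0, zero_add] at hne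
      split_ifs at hne with hlt
      · rw [Pi.smul_apply, smul_eq_mul] at hne
        have h1 := right_ne_zero_of_mul hne
        have hE := (edge_mul t hlt).le
        have h2 := ih hL' (hE.trans hy) h1
        have h3 : BruhatLE x (t.1 * y) := by
          by_contra hc; exact h1 (pathGF_eq_zero L hc)
        by_contra hc
        exact IsSmall.not_of_leaving hlt h2 ⟨h3, hE.trans hy⟩ hc ⟨h3.trans hE, hy⟩
          (hL t (by simp))
      · simp at hne
    · exact ih hL' hy h0

open Classical in
/-- The relative `R̃`-polynomial counts increasing paths with no small label. -/
lemma relRTilde_eq_pathGF {n : ℕ} {u v : Sym n} {I : Finset (Sym n)}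
    (hI : IsOrderIdeal u v I) {x : Sym n} (hx : x ∈ I)
    {r : Reflection n → Reflection n → Prop} (hr : IsReflectionOrder r)
    (hE : ∀ (x₁ x₂ : Sym n) (e₁ : Edge x₁ x₂), x₁ ∈ I → InInterval x v x₁ → x₂ ∈ I →
      InInterval x v x₂ → IsSmall r v I x ⟨x₂ * x₁⁻¹, e₁.1⟩)
    {L : List (Reflection n)} (hL : IsListing r L) :
    relRTilde x v I = pathGF (L.filter fun t => ! decide (IsSmall r v I x t)) v x := by
  have := hr.1
  set p : Reflection n → Bool := fun t => decide (IsSmall r v I x t) with hp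
  have hsplit : L = L.filter (fun t => !p t) ++ L.filter p :=
    filter_append_filter_of_pairwise p
      (fun a b h ha => by simpa [hp] using IsSmall.of_lt (by simpa [hp] using ha) h) L hL.1
  have hu : BruhatLE u x := (hI.1 x hx).1
  have key : relRTilde x v I =
      (negX (pathMatrix (L.filter p).reverse) * pathMatrix L) x v := by
    rw [Matrix.mul_apply, relRTilde, Finset.sum_filter, ← Finset.sum_subset I.subset_univ]
    · refine Finset.sum_congr rfl fun y hy => ?_
      split_ifs with hxy
      · rw [rTilde_eq_pathGF hr.flip hL.reverse, rTilde_eq_pathGF hr hL,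
          pathGF_eq_pathGF_filter L.reverse p, List.filter_reverse]
        · rfl
        · intro t z hz hlt hxz
          have hE' := edge_mul t hlt
          have hzv := hz.trans hxy.2
          have hzI : z ∈ I := hI.2 y hy z
            ⟨hu.trans (hxz.trans hE'.le), hz.trans (hI.1 y hy).2⟩ hz
          have htI : t.1 * z ∈ I := hI.2 z hzI _ ⟨hu.trans hxz, hE'.le.trans (hI.1 z hzI).2⟩ hE'.le
          have := hE _ _ hE' htI ⟨hxz, hE'.le.trans hzv⟩ hzI ⟨hxz.trans hE'.le, hzv⟩
          simp only [label_mul'] at this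
          simpa [hp] using this
      · by_cases hyv : BruhatLE y v
        · have hxy' : ¬ BruhatLE x y := fun h => hxy ⟨h, hyv⟩
          have : negX (pathMatrix (L.filter p).reverse) x y = 0 := by
            simp [negX, pathMatrix, pathGF_eq_zero _ hxy']
          rw [this, zero_mul]
        · have : pathMatrix L y v = 0 := by simp [pathMatrix, pathGF_eq_zero _ hyv]
          rw [this, mul_zero]
    · intro y _ hy
      by_cases hyv : BruhatLE y v
      · have : pathGF (L.filter p).reverse y x = 0 := by
          by_contra hne
          exact hy (mem_of_pathGF_ne_zero (r := r) hx _ (by simp [hp]) hyv hne)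
        have : negX (pathMatrix (L.filter p).reverse) x y = 0 := by
          simp [negX, pathMatrix, this]
        rw [this, zero_mul]
      · have : pathMatrix L y v = 0 := by simp [pathMatrix, pathGF_eq_zero _ hyv]
        rw [this, mul_zero]
  rw [key]
  have hmat : pathMatrix L =
      pathMatrix (L.filter p) * pathMatrix (L.filter fun t => !p t) := by
    rw [← pathMatrix_append, ← hsplit]
  rw [hmat, ← mul_assoc, negX_pathMatrix_reverse_mul, one_mul]
  rfl

/-- `l` is the list of labels, read from the end, of a path from `u` to `v`. -/
def IsPathTo {n : ℕ} (u : Sym n) : List (Reflection n) → Sym n → Prop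
  | [], v => u = v
  | t :: l, v => length (t.1 * v) < length v ∧ IsPathTo u l (t.1 * v)

open Classical in
lemma pathGF_eq_sum {n : ℕ} (L : List (Reflection n)) (hL : L.Nodup) (u v : Sym n) :
    pathGF L v u = ∑ l ∈ L.sublists'.toFinset with IsPathTo u l v, X ^ l.length := by
  have key : pathGF L v u =
      (L.sublists'.map fun l => if IsPathTo u l v then (X : ℤ[X]) ^ l.length else 0).sum := by
    clear hL
    induction L generalizing v with
    | nil => simp [pathGF, IsPathTo, Pi.single_apply]
    | cons t L ih =>
      rw [List.sublists'_cons, List.map_append, List.sum_append, ← ih, List.map_map, pathGF,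
        Pi.add_apply]
      congr 1
      split_ifs with h
      · rw [Pi.smul_apply, ih, smul_eq_mul, ← List.sum_map_mul_left]
        congr 1
        refine List.map_congr_left fun l _ => ?_
        simp only [Function.comp_apply, IsPathTo, h, true_and, List.length_cons]
        split_ifs <;> ring
      · symm
        apply List.sum_eq_zero
        simp [IsPathTo, h]
  rw [key, Finset.sum_filter, List.sum_toFinset _ (List.nodup_sublists'.2 hL)]

/-! ### Diamonds of the Bruhat graph -/

/-- `x → t₁ x → t₂ t₁ x` is a path in the Bruhat graph. -/
def IsTwoPath {n : ℕ} (x : Sym n) (t₁ t₂ : Reflection n) : Prop :=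
  length x < length (t₁.1 * x) ∧ length (t₁.1 * x) < length (t₂.1 * (t₁.1 * x))

lemma IsTwoPath.ne {n : ℕ} {x : Sym n} {t₁ t₂ : Reflection n} (h : IsTwoPath x t₁ t₂) :
    t₁ ≠ t₂ := by
  rintro rfl
  have := h.2
  rw [t₁.mul_mul_cancel] at this
  exact h.1.not_gt this

lemma isTwoPath_transposition_iff {n : ℕ} {x : Sym n} {a b c d : Fin n} (hab : a < b)
    (hcd : c < d) :
    IsTwoPath x (transposition a b hab) (transposition c d hcd) ↔
      x⁻¹ a < x⁻¹ b ∧ x⁻¹ (Equiv.swap a b c) < x⁻¹ (Equiv.swap a b d) := by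
  unfold IsTwoPath transposition
  rw [length_lt_swap_mul_iff _ hab, length_lt_swap_mul_iff _ hcd]
  simp

lemma eq_swap_of_isSwap {n : ℕ} {t : Sym n} (ht : t.IsSwap) {e f : Fin n} (hef : e ≠ f)
    (h : t f = e) : t = Equiv.swap e f := by
  obtain ⟨p, q, hpq, rfl⟩ := ht
  rw [Equiv.swap_apply_def] at h
  split_ifs at h with h1 h2
  · subst h h1; exact Equiv.swap_comm _ _
  · subst h h2; rfl
  · exact absurd h.symm hef

lemma apply_ne_of_swap_factor {n : ℕ} {g t : Sym n} (ht : t.IsSwap) {e f : Fin n} (hef : e ≠ f)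
    (h : t * Equiv.swap e f = g) (hg : g ≠ 1) : g e ≠ e ∧ g f ≠ f := by
  constructor
  · intro he
    apply hg
    have : t f = e := by
      rw [← h] at he; simpa using he
    rw [← h, eq_swap_of_isSwap ht hef this, Equiv.swap_mul_self]
  · intro hf
    apply hg
    have : t e = f := by
      rw [← h] at hf; simpa using hf
    rw [← h, eq_swap_of_isSwap ht hef.symm this, Equiv.swap_comm, Equiv.swap_mul_self]

lemma swap_mul_swap_ac_ab {n : ℕ} {a b c : Fin n} (hab : a < b) (hbc : b < c) :
    Equiv.swap a c * Equiv.swap a b = Equiv.swap b c * Equiv.swap a c ∧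
    Equiv.swap a c * Equiv.swap a b = Equiv.swap a b * Equiv.swap b c := by
  constructor <;> ext1 i <;> simp only [Equiv.Perm.mul_apply, Equiv.swap_apply_def] <;> grind

lemma swap_mul_swap_bc_ab {n : ℕ} {a b c : Fin n} (hab : a < b) (hbc : b < c) :
    Equiv.swap b c * Equiv.swap a b = Equiv.swap a c * Equiv.swap b c ∧
    Equiv.swap b c * Equiv.swap a b = Equiv.swap a b * Equiv.swap a c := by
  constructor <;> ext1 i <;> simp only [Equiv.Perm.mul_apply, Equiv.swap_apply_def] <;> grind

/-- The partner of the two-step path with labels `t₁, t₂` has labels `t₃, t₄`. -/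
def IsPartner {n : ℕ} (r : Reflection n → Reflection n → Prop) (x : Sym n)
    (t₁ t₂ t₃ t₄ : Reflection n) : Prop :=
  t₄.1 * t₃.1 = t₂.1 * t₁.1 ∧ IsTwoPath x t₃ t₄ ∧ t₃ ≠ t₁ ∧
  ((r t₁ t₂ ∧ r t₄ t₃ ∧ r t₁ t₃ ∧ r t₄ t₂) ∨ (r t₂ t₁ ∧ r t₃ t₄ ∧ r t₃ t₁ ∧ r t₂ t₄)) ∧
  ∀ t₅ t₆ : Reflection n, t₆.1 * t₅.1 = t₂.1 * t₁.1 → IsTwoPath x t₅ t₆ → t₅ = t₁ ∨ t₅ = t₃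

lemma IsPartner.symm {n : ℕ} {r : Reflection n → Reflection n → Prop} {x : Sym n}
    {t₁ t₂ t₃ t₄ : Reflection n} (h : IsPartner r x t₁ t₂ t₃ t₄) (h' : IsTwoPath x t₁ t₂) :
    IsPartner r x t₃ t₄ t₁ t₂ := by
  obtain ⟨h1, h2, h3, h4, h5⟩ := h
  refine ⟨h1.symm, h', h3.symm, h4.symm.imp (fun h => ?_) (fun h => ?_), fun t₅ t₆ e h => ?_⟩
  · tauto
  · tauto
  · exact (h5 t₅ t₆ (e.trans h1) h).symm

lemma factor_mem_triple {n : ℕ} {a b c : Fin n} (hab : a < b) (hbc : b < c) {g : Sym n}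
    (hg : g ≠ 1) (hfix : ∀ i, i ≠ a → i ≠ b → i ≠ c → g i = i) (t t' : Reflection n)
    (h : t'.1 * t.1 = g) :
    t = transposition a b hab ∨ t = transposition a c (hab.trans hbc) ∨
      t = transposition b c hbc := by
  obtain ⟨e, f, hef, rfl⟩ := exists_eq_transposition t
  obtain ⟨he, hf⟩ := apply_ne_of_swap_factor t'.2 hef.ne h hg
  have he' : e = a ∨ e = b ∨ e = c := by
    by_contra! hc; exact he (hfix e hc.1 hc.2.1 hc.2.2)
  have hf' : f = a ∨ f = b ∨ f = c := by
    by_contra! hc; exact hf (hfix f hc.1 hc.2.1 hc.2.2)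
  simp only [transposition_inj]
  rcases he' with rfl | rfl | rfl <;> rcases hf' with rfl | rfl | rfl <;> omega

lemma reflection_eq_of_mul_eq {n : ℕ} {t t' : Reflection n} {a : Sym n}
    (h : t.1 * a = t'.1 * a) : t = t' :=
  Subtype.ext (mul_right_cancel h)

section Triple

variable {n : ℕ} {x : Sym n} {a b c : Fin n}

lemma isTwoPath_ab_ac (hab : a < b) (hbc : b < c) :
    IsTwoPath x (transposition a b hab) (transposition a c (hab.trans hbc)) ↔
    x⁻¹ a < x⁻¹ b ∧ x⁻¹ b < x⁻¹ c := by
  rw [isTwoPath_transposition_iff, Equiv.swap_apply_left,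
    Equiv.swap_apply_of_ne_of_ne (hab.trans hbc).ne' hbc.ne']

lemma isTwoPath_ab_bc (hab : a < b) (hbc : b < c) :
    IsTwoPath x (transposition a b hab) (transposition b c hbc) ↔
    x⁻¹ a < x⁻¹ b ∧ x⁻¹ a < x⁻¹ c := by
  rw [isTwoPath_transposition_iff, Equiv.swap_apply_right,
    Equiv.swap_apply_of_ne_of_ne (hab.trans hbc).ne' hbc.ne']

lemma isTwoPath_ac_ab (hab : a < b) (hbc : b < c) :
    IsTwoPath x (transposition a c (hab.trans hbc)) (transposition a b hab) ↔
    x⁻¹ a < x⁻¹ c ∧ x⁻¹ c < x⁻¹ b := by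
  rw [isTwoPath_transposition_iff, Equiv.swap_apply_left,
    Equiv.swap_apply_of_ne_of_ne hab.ne' hbc.ne]

lemma isTwoPath_ac_bc (hab : a < b) (hbc : b < c) :
    IsTwoPath x (transposition a c (hab.trans hbc)) (transposition b c hbc) ↔
    x⁻¹ a < x⁻¹ c ∧ x⁻¹ b < x⁻¹ a := by
  rw [isTwoPath_transposition_iff, Equiv.swap_apply_right,
    Equiv.swap_apply_of_ne_of_ne hab.ne' hbc.ne]

lemma isTwoPath_bc_ab (hab : a < b) (hbc : b < c) :
    IsTwoPath x (transposition b c hbc) (transposition a b hab) ↔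
    x⁻¹ b < x⁻¹ c ∧ x⁻¹ a < x⁻¹ c := by
  rw [isTwoPath_transposition_iff, Equiv.swap_apply_left,
    Equiv.swap_apply_of_ne_of_ne hab.ne (hab.trans hbc).ne]

lemma isTwoPath_bc_ac (hab : a < b) (hbc : b < c) :
    IsTwoPath x (transposition b c hbc) (transposition a c (hab.trans hbc)) ↔
    x⁻¹ b < x⁻¹ c ∧ x⁻¹ a < x⁻¹ b := by
  rw [isTwoPath_transposition_iff, Equiv.swap_apply_right,
    Equiv.swap_apply_of_ne_of_ne hab.ne (hab.trans hbc).ne]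

lemma exists_partner_ac_ab (hab : a < b) (hbc : b < c)
    {r : Reflection n → Reflection n → Prop} (hr : IsReflectionOrder r)
    {t₁ t₂ : Reflection n} (h : IsTwoPath x t₁ t₂)
    (hprod : t₂.1 * t₁.1 = Equiv.swap a c * Equiv.swap a b) :
    ∃ t₃ t₄, IsPartner r x t₁ t₂ t₃ t₄ := by
  have := hr.1
  obtain ⟨e1, e2⟩ := swap_mul_swap_ac_ab hab hbc
  have hg : Equiv.swap a c * Equiv.swap a b ≠ 1 := fun hc => by
    have := DFunLike.congr_fun hc a
    simp [Equiv.swap_apply_of_ne_of_ne hab.ne' hbc.ne, hab.ne'] at this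
  have hfix : ∀ i, i ≠ a → i ≠ b → i ≠ c → (Equiv.swap a c * Equiv.swap a b) i = i := by
    intro i h1 h2 h3
    simp [Equiv.swap_apply_of_ne_of_ne, h1, h2, h3]
  have mem := factor_mem_triple hab hbc hg hfix
  have det : ∀ t t' : Reflection n, t'.1 * t.1 = Equiv.swap a c * Equiv.swap a b →
      (t = transposition a b hab ∧ t' = transposition a c (hab.trans hbc)) ∨
      (t = transposition a c (hab.trans hbc) ∧ t' = transposition b c hbc) ∨
      (t = transposition b c hbc ∧ t' = transposition a b hab) := by
    intro t t' ht
    rcases mem t t' ht with rfl | rfl | rfl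
    · exact Or.inl ⟨rfl, reflection_eq_of_mul_eq ht⟩
    · exact Or.inr (Or.inl ⟨rfl, reflection_eq_of_mul_eq (ht.trans e1)⟩)
    · exact Or.inr (Or.inr ⟨rfl, reflection_eq_of_mul_eq (ht.trans e2)⟩)
  have hord := hr.2 a b c hab hbc
  have n1 : transposition a b hab ≠ transposition b c hbc := by
    rw [Ne, transposition_inj]; omega
  have n2 : transposition a c (hab.trans hbc) ≠ transposition b c hbc := by
    rw [Ne, transposition_inj]; omega
  have r1 := isTwoPath_ab_ac (x := x) hab hbc
  have r2 := isTwoPath_ac_bc (x := x) hab hbc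
  have r3 := isTwoPath_bc_ab (x := x) hab hbc
  have tr : ∀ t t' t'', r t t' → r t' t'' → r t t'' := fun _ _ _ => trans_of r
  have p1 : IsTwoPath x (transposition a b hab) (transposition a c (hab.trans hbc)) →
      IsPartner r x (transposition a b hab) (transposition a c (hab.trans hbc))
        (transposition b c hbc) (transposition a b hab) := by
    intro h
    have h' := r1.1 h
    refine ⟨e2.symm, r3.2 ⟨h'.2, h'.1.trans h'.2⟩, n1.symm, ?_, fun t₅ t₆ e h5 => ?_⟩
    · rcases hord with ⟨o1, o2⟩ | ⟨o1, o2⟩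
      · exact Or.inl ⟨o1, tr _ _ _ o1 o2, tr _ _ _ o1 o2, o1⟩
      · exact Or.inr ⟨o2, tr _ _ _ o1 o2, tr _ _ _ o1 o2, o2⟩
    · rcases det t₅ t₆ e with ⟨rfl, rfl⟩ | ⟨rfl, rfl⟩ | ⟨rfl, rfl⟩
      · exact Or.inl rfl
      · exact absurd (r2.1 h5).2 h'.1.not_gt
      · exact Or.inr rfl
  have p2 : IsTwoPath x (transposition a c (hab.trans hbc)) (transposition b c hbc) →
      IsPartner r x (transposition a c (hab.trans hbc)) (transposition b c hbc)
        (transposition b c hbc) (transposition a b hab) := by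
    intro h
    have h' := r2.1 h
    refine ⟨e2.symm.trans e1, r3.2 ⟨h'.2.trans h'.1, h'.1⟩, n2.symm, ?_, fun t₅ t₆ e h5 => ?_⟩
    · rcases hord with ⟨o1, o2⟩ | ⟨o1, o2⟩
      · exact Or.inl ⟨o2, tr _ _ _ o1 o2, o2, tr _ _ _ o1 o2⟩
      · exact Or.inr ⟨o1, tr _ _ _ o1 o2, o1, tr _ _ _ o1 o2⟩
    · rcases det t₅ t₆ (e.trans e1.symm) with ⟨rfl, rfl⟩ | ⟨rfl, rfl⟩ | ⟨rfl, rfl⟩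
      · exact absurd (r1.1 h5).1 h'.2.not_gt
      · exact Or.inl rfl
      · exact Or.inr rfl
  rcases det t₁ t₂ hprod with ⟨rfl, rfl⟩ | ⟨rfl, rfl⟩ | ⟨rfl, rfl⟩
  · exact ⟨_, _, p1 h⟩
  · exact ⟨_, _, p2 h⟩
  · have h' := r3.1 h
    rcases lt_trichotomy (x⁻¹ a) (x⁻¹ b) with h3 | h3 | h3
    · have h4 := r1.2 ⟨h3, h'.1⟩
      exact ⟨_, _, (p1 h4).symm h4⟩
    · exact absurd (x⁻¹.injective h3) hab.ne
    · have h4 := r2.2 ⟨h'.2, h3⟩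
      exact ⟨_, _, (p2 h4).symm h4⟩

lemma exists_partner_bc_ab (hab : a < b) (hbc : b < c)
    {r : Reflection n → Reflection n → Prop} (hr : IsReflectionOrder r)
    {t₁ t₂ : Reflection n} (h : IsTwoPath x t₁ t₂)
    (hprod : t₂.1 * t₁.1 = Equiv.swap b c * Equiv.swap a b) :
    ∃ t₃ t₄, IsPartner r x t₁ t₂ t₃ t₄ := by
  have := hr.1
  obtain ⟨e1, e2⟩ := swap_mul_swap_bc_ab hab hbc
  have hg : Equiv.swap b c * Equiv.swap a b ≠ 1 := fun hc => by
    have := DFunLike.congr_fun hc a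
    simp [(hab.trans hbc).ne'] at this
  have hfix : ∀ i, i ≠ a → i ≠ b → i ≠ c → (Equiv.swap b c * Equiv.swap a b) i = i := by
    intro i h1 h2 h3
    simp [Equiv.swap_apply_of_ne_of_ne, h1, h2, h3]
  have mem := factor_mem_triple hab hbc hg hfix
  have det : ∀ t t' : Reflection n, t'.1 * t.1 = Equiv.swap b c * Equiv.swap a b →
      (t = transposition a b hab ∧ t' = transposition b c hbc) ∨
      (t = transposition b c hbc ∧ t' = transposition a c (hab.trans hbc)) ∨
      (t = transposition a c (hab.trans hbc) ∧ t' = transposition a b hab) := by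
    intro t t' ht
    rcases mem t t' ht with rfl | rfl | rfl
    · exact Or.inl ⟨rfl, reflection_eq_of_mul_eq ht⟩
    · exact Or.inr (Or.inr ⟨rfl, reflection_eq_of_mul_eq (ht.trans e2)⟩)
    · exact Or.inr (Or.inl ⟨rfl, reflection_eq_of_mul_eq (ht.trans e1)⟩)
  have hord := hr.2 a b c hab hbc
  have n1 : transposition a b hab ≠ transposition b c hbc := by
    rw [Ne, transposition_inj]; omega
  have n2 : transposition a b hab ≠ transposition a c (hab.trans hbc) := by
    rw [Ne, transposition_inj]; omega
  have r1 := isTwoPath_ab_bc (x := x) hab hbc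
  have r2 := isTwoPath_bc_ac (x := x) hab hbc
  have r3 := isTwoPath_ac_ab (x := x) hab hbc
  have tr : ∀ t t' t'', r t t' → r t' t'' → r t t'' := fun _ _ _ => trans_of r
  have p2 : IsTwoPath x (transposition b c hbc) (transposition a c (hab.trans hbc)) →
      IsPartner r x (transposition b c hbc) (transposition a c (hab.trans hbc))
        (transposition a b hab) (transposition b c hbc) := by
    intro h
    have h' := r2.1 h
    refine ⟨e1, r1.2 ⟨h'.2, h'.2.trans h'.1⟩, n1, ?_, fun t₅ t₆ e h5 => ?_⟩
    · rcases hord with ⟨o1, o2⟩ | ⟨o1, o2⟩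
      · exact Or.inr ⟨o2, tr _ _ _ o1 o2, tr _ _ _ o1 o2, o2⟩
      · exact Or.inl ⟨o1, tr _ _ _ o1 o2, tr _ _ _ o1 o2, o1⟩
    · rcases det t₅ t₆ (e.trans e1.symm) with ⟨rfl, rfl⟩ | ⟨rfl, rfl⟩ | ⟨rfl, rfl⟩
      · exact Or.inr rfl
      · exact Or.inl rfl
      · exact absurd (r3.1 h5).2 h'.1.not_gt
  have p3 : IsTwoPath x (transposition a c (hab.trans hbc)) (transposition a b hab) →
      IsPartner r x (transposition a c (hab.trans hbc)) (transposition a b hab)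
        (transposition a b hab) (transposition b c hbc) := by
    intro h
    have h' := r3.1 h
    refine ⟨e2, r1.2 ⟨h'.1.trans h'.2, h'.1⟩, n2, ?_, fun t₅ t₆ e h5 => ?_⟩
    · rcases hord with ⟨o1, o2⟩ | ⟨o1, o2⟩
      · exact Or.inr ⟨o1, tr _ _ _ o1 o2, o1, tr _ _ _ o1 o2⟩
      · exact Or.inl ⟨o2, tr _ _ _ o1 o2, o2, tr _ _ _ o1 o2⟩
    · rcases det t₅ t₆ (e.trans e2.symm) with ⟨rfl, rfl⟩ | ⟨rfl, rfl⟩ | ⟨rfl, rfl⟩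
      · exact Or.inr rfl
      · exact absurd (r2.1 h5).1 h'.2.not_gt
      · exact Or.inl rfl
  rcases det t₁ t₂ hprod with ⟨rfl, rfl⟩ | ⟨rfl, rfl⟩ | ⟨rfl, rfl⟩
  · have h' := r1.1 h
    rcases lt_trichotomy (x⁻¹ b) (x⁻¹ c) with h3 | h3 | h3
    · have h4 := r2.2 ⟨h3, h'.1⟩
      exact ⟨_, _, (p2 h4).symm h4⟩
    · exact absurd (x⁻¹.injective h3) hbc.ne
    · have h4 := r3.2 ⟨h'.2, h3⟩
      exact ⟨_, _, (p3 h4).symm h4⟩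
  · exact ⟨_, _, p2 h⟩
  · exact ⟨_, _, p3 h⟩

end Triple

lemma exists_partner_of_disjoint {n : ℕ} {x : Sym n} {r : Reflection n → Reflection n → Prop}
    (hr : IsReflectionOrder r) {a b c d : Fin n} (hab : a < b) (hcd : c < d)
    (hac : a ≠ c) (had : a ≠ d) (hbc : b ≠ c) (hbd : b ≠ d)
    (h : IsTwoPath x (transposition a b hab) (transposition c d hcd)) :
    ∃ t₃ t₄, IsPartner r x (transposition a b hab) (transposition c d hcd) t₃ t₄ := by
  have := hr.1
  have hcomm : Equiv.swap a b * Equiv.swap c d = Equiv.swap c d * Equiv.swap a b := by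
    ext1 i
    simp only [Equiv.Perm.mul_apply, Equiv.swap_apply_def]
    grind
  refine ⟨transposition c d hcd, transposition a b hab, hcomm, ?_, h.ne.symm, ?_, ?_⟩
  · rw [isTwoPath_transposition_iff] at h ⊢
    rw [Equiv.swap_apply_of_ne_of_ne hac.symm hbc.symm,
      Equiv.swap_apply_of_ne_of_ne had.symm hbd.symm] at h
    rw [Equiv.swap_apply_of_ne_of_ne hac had, Equiv.swap_apply_of_ne_of_ne hbc hbd]
    exact h.symm
  · rcases trichotomous_of r (transposition a b hab) (transposition c d hcd) with h' | h' | h'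
    · exact Or.inl ⟨h', h', h', h'⟩
    · exact absurd h' h.ne
    · exact Or.inr ⟨h', h', h', h'⟩
  · intro t₅ t₆ e h5
    obtain ⟨p, q, hpq, rfl⟩ := exists_eq_transposition t₅
    set g : Sym n := Equiv.swap c d * Equiv.swap a b with hg
    have e' : t₆.1 * Equiv.swap p q = g := e
    have hgd : ∀ i, g i = if i = a then b else if i = b then a else if i = c then d
        else if i = d then c else i := by
      intro i
      simp only [hg, Equiv.Perm.mul_apply, Equiv.swap_apply_def]
      grind
    have hg1 : g ≠ 1 := fun hc => by
      have := DFunLike.congr_fun hc a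
      rw [hgd] at this
      simp [hab.ne'] at this
    obtain ⟨h1, h2⟩ := apply_ne_of_swap_factor t₆.2 hpq.ne e' hg1
    have ht6 : ∀ i, t₆.1 i = g (Equiv.swap p q i) := by
      intro i; rw [← e']; simp
    have inv : g (Equiv.swap p q (g q)) = p := by
      have h3 : t₆.1 p = g q := by rw [ht6]; simp
      have h4 : t₆.1 (t₆.1 p) = p := by
        rw [← Equiv.Perm.mul_apply, t₆.mul_self, Equiv.Perm.one_apply]
      rw [← ht6, ← h3, h4]
    rw [transposition_inj, transposition_inj]
    simp only [hgd, Equiv.swap_apply_def] at h1 h2 inv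
    grind

/-- Every two-step path in the Bruhat graph lies on exactly one diamond; exactly one of the two
sides of the diamond is increasing, with the smaller first label and the larger last label. -/
lemma exists_partner {n : ℕ} {x : Sym n} {r : Reflection n → Reflection n → Prop}
    (hr : IsReflectionOrder r) {t₁ t₂ : Reflection n} (h : IsTwoPath x t₁ t₂) :
    ∃ t₃ t₄, IsPartner r x t₁ t₂ t₃ t₄ := by
  have hne := h.ne
  obtain ⟨a, b, hab, rfl⟩ := exists_eq_transposition t₁
  obtain ⟨c, d, hcd, rfl⟩ := exists_eq_transposition t₂
  rw [Ne, transposition_inj] at hne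
  by_cases hac : a = c
  · subst hac
    rcases lt_trichotomy b d with hbd | hbd | hbd
    · exact exists_partner_ac_ab hab hbd hr h rfl
    · exact absurd ⟨rfl, hbd⟩ hne
    · exact exists_partner_bc_ab hcd hbd hr h (swap_mul_swap_bc_ab hcd hbd).2.symm
  by_cases hbd : b = d
  · subst hbd
    rcases lt_or_gt_of_ne hac with hac | hac
    · exact exists_partner_ac_ab hac hcd hr h (swap_mul_swap_ac_ab hac hcd).1.symm
    · exact exists_partner_bc_ab hac hab hr h (swap_mul_swap_bc_ab hac hab).1.symm
  by_cases had : a = d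
  · subst had
    exact exists_partner_ac_ab hcd hab hr h (swap_mul_swap_ac_ab hcd hab).2.symm
  by_cases hbc : b = c
  · subst hbc
    exact exists_partner_bc_ab hab hcd hr h rfl
  exact exists_partner_of_disjoint hr hab hcd hac had hbc hbd h

/-! ### The hypercube map on the faces of a hypercube -/

lemma IsCubeWith.top_unique {n : ℕ} {u v : Sym n} {H : Subgraph u v} {x x' : Sym n}
    {Y Y' : Finset (Sym n)} {w w' : Sym n} (h : IsCubeWith H x Y w) (h' : IsCubeWith H x' Y' w') :
    w = w' := by
  obtain ⟨k, φ, -, -, rfl⟩ := h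
  obtain ⟨k', ψ, -, -, rfl⟩ := h'
  by_contra hne
  set A := ψ.symm (φ Finset.univ) with hA
  have hA' : ψ A = φ Finset.univ := by simp [hA]
  have hAne : A ≠ Finset.univ := by
    intro hc
    rw [hc] at hA'
    exact hne (by rw [hA'])
  obtain ⟨i, hi⟩ : ∃ i, i ∉ A := by
    by_contra! hc
    exact hAne (Finset.eq_univ_iff_forall.2 hc)
  have hcov : A ⋖ insert i A := Finset.covBy_insert hi
  have hadj := ψ.map_rel_iff.2 hcov
  rw [hA', ← φ.apply_symm_apply (ψ (insert i A))] at hadj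
  exact (φ.map_rel_iff.1 hadj).lt.not_ge (Finset.subset_univ _)

/-- The face of a hypercube given by an injection of coordinates. -/
def face {n : ℕ} {u v : Sym n} {H : Subgraph u v} {k m : ℕ} (φ : CubeIso k H)
    (e : Fin m ↪ Fin k) : Subgraph u v where
  verts := Set.range fun A : Finset (Fin m) => (φ (A.map e) : Sym n)
  Adj a b := ∃ A B : Finset (Fin m), A ⋖ B ∧ (φ (A.map e) : Sym n) = a ∧
    (φ (B.map e) : Sym n) = b
  verts_mem := by
    rintro _ ⟨A, rfl⟩
    exact H.verts_mem _ (φ _).2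
  adj_verts := by
    rintro _ _ ⟨A, B, -, rfl, rfl⟩
    exact ⟨⟨A, rfl⟩, ⟨B, rfl⟩⟩
  adj_edge := by
    rintro _ _ ⟨A, B, hAB, rfl, rfl⟩
    refine H.adj_edge _ _ (φ.map_rel_iff.2 ?_)
    rw [Finset.covBy_iff_exists_insert] at hAB ⊢
    obtain ⟨i, hi, rfl⟩ := hAB
    exact ⟨e i, by simpa using hi, by rw [Finset.map_insert]⟩

lemma face_injective {n : ℕ} {u v : Sym n} {H : Subgraph u v} {k m : ℕ} (φ : CubeIso k H)
    (e : Fin m ↪ Fin k) :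
    Function.Injective fun A : Finset (Fin m) => (φ (A.map e) : Sym n) := by
  intro A B h
  exact Finset.map_injective e (φ.injective (Subtype.ext h))

/-- The hypercube structure of a face. -/
noncomputable def faceIso {n : ℕ} {u v : Sym n} {H : Subgraph u v} {k m : ℕ} (φ : CubeIso k H)
    (e : Fin m ↪ Fin k) : CubeIso m (face φ e) where
  toEquiv := Equiv.ofInjective _ (face_injective φ e)
  map_rel_iff' := by
    intro A B
    constructor
    · rintro ⟨A', B', h, hA, hB⟩
      rwa [← face_injective φ e hA, ← face_injective φ e hB]
    · intro h
      exact ⟨A, B, h, rfl, rfl⟩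

lemma faceIso_apply {n : ℕ} {u v : Sym n} {H : Subgraph u v} {k m : ℕ} (φ : CubeIso k H)
    (e : Fin m ↪ Fin k) (A : Finset (Fin m)) :
    (faceIso φ e A : Sym n) = φ (A.map e) := rfl

lemma cube_adj_bottom_iff {n : ℕ} {u v : Sym n} {H : Subgraph u v} {k : ℕ} (φ : CubeIso k H)
    (y : Sym n) : H.Adj (φ ∅) y ↔ ∃ i, (φ {i} : Sym n) = y := by
  constructor
  · intro h
    have hy := (H.adj_verts _ _ h).2
    have h' : H.Adj (φ ∅) (φ (φ.symm ⟨y, hy⟩)) := by simpa using h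
    obtain ⟨i, hi, hi'⟩ := (Finset.covBy_iff_exists_insert).1 (φ.map_rel_iff.1 h')
    refine ⟨i, ?_⟩
    have : ({i} : Finset (Fin k)) = φ.symm ⟨y, hy⟩ := by simpa using hi'
    rw [this]; simp
  · rintro ⟨i, rfl⟩
    refine φ.map_rel_iff.2 ?_
    exact Finset.covBy_iff_exists_insert.2 ⟨i, by simp, by simp⟩

lemma isCubeWith_face {n : ℕ} {u v : Sym n} {H : Subgraph u v} {k m : ℕ} (φ : CubeIso k H)
    (e : Fin m ↪ Fin k) (Y : Finset (Sym n)) (hY : ∀ y, y ∈ Y ↔ ∃ i, (φ {e i} : Sym n) = y) :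
    IsCubeWith (face φ e) (φ ∅) Y (φ (Finset.univ.map e)) := by
  refine ⟨m, faceIso φ e, rfl, fun y => ?_, rfl⟩
  have := cube_adj_bottom_iff (faceIso φ e) y
  rw [hY]
  simpa [faceIso_apply] using this.symm

section Cluster

variable {n : ℕ} {u v : Sym n} {I : Finset (Sym n)} {x : Sym n}

lemma mem_antichains {Y : Finset (Sym n)} : Y ∈ antichains u v I x ↔
    (∀ y ∈ Y, InInterval u v y ∧ y ∉ I ∧ Edge x y) ∧
      IsAntichain BruhatLE (Y : Set (Sym n)) := by
  simp [antichains]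

lemma antichains_mono {Y Z : Finset (Sym n)} (hY : Y ∈ antichains u v I x) (h : Z ⊆ Y) :
    Z ∈ antichains u v I x := by
  rw [mem_antichains] at hY ⊢
  exact ⟨fun y hy => hY.1 y (h hy), hY.2.subset (by exact_mod_cast h)⟩

lemma theta_eq (hcl : HasHypercubeCluster u v I x) {Y : Finset (Sym n)}
    (hY : Y ∈ antichains u v I x) {H : Subgraph u v} {w : Sym n} (h : IsCubeWith H x Y w) :
    theta u v x Y = w := by
  have hs : ∃ H : Subgraph u v, IsCubeWith H x Y (theta u v x Y) :=
    Classical.epsilon_spec (p := fun w => ∃ H : Subgraph u v, IsCubeWith H x Y w) ⟨w, H, h⟩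
  obtain ⟨H', hH'⟩ := hs
  have := (hcl Y hY).unique ⟨_, h⟩ ⟨_, hH'⟩
  subst this
  exact hH'.top_unique h

/-- The hypercube spanned by `Y` is the image of the subsets of `Y` under `θ_x`. -/
lemma exists_cube (hcl : HasHypercubeCluster u v I x) {Y : Finset (Sym n)}
    (hY : Y ∈ antichains u v I x) :
    ∃ (H : Subgraph u v) (k : ℕ) (φ : CubeIso k H) (f : Finset (Sym n) → Finset (Fin k)),
      (φ ∅ : Sym n) = x ∧ (∀ y ∈ Y, ∃ i, (φ {i} : Sym n) = y) ∧
      (∀ Z i, i ∈ f Z ↔ (φ {i} : Sym n) ∈ Z) ∧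
      ∀ Z ⊆ Y, theta u v x Z = φ (f Z) := by
  classical
  obtain ⟨H, ⟨w, k, φ, hbot, hadj, -⟩, -⟩ := hcl Y hY
  have hadj' : ∀ y, y ∈ Y ↔ ∃ i, (φ {i} : Sym n) = y := by
    intro y
    rw [hadj, ← cube_adj_bottom_iff, hbot]
  refine ⟨H, k, φ, fun Z => {i | (φ {i} : Sym n) ∈ Z}, hbot, fun y hy => (hadj' y).1 hy,
    by simp, fun Z hZ => ?_⟩
  set S : Finset (Fin k) := {i | (φ {i} : Sym n) ∈ Z} with hS
  set e : Fin S.card ↪ Fin k := (S.orderEmbOfFin rfl).toEmbedding with he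
  have hmap : Finset.univ.map e = S := by
    simp [he]
  have := isCubeWith_face φ e Z fun y => by
    constructor
    · intro hy
      obtain ⟨i, hi⟩ := (hadj' y).1 (hZ hy)
      have hiS : i ∈ S := by simp [hS, hi, hy]
      rw [← hmap] at hiS
      obtain ⟨j, -, hj⟩ := Finset.mem_map.1 hiS
      exact ⟨j, by rw [hj, hi]⟩
    · rintro ⟨j, rfl⟩
      have : e j ∈ S := S.orderEmbOfFin_mem rfl j
      simpa [hS] using this
  rw [hbot, hmap] at this
  exact theta_eq hcl (antichains_mono hY hZ) this

lemma theta_edge (hcl : HasHypercubeCluster u v I x) {Z : Finset (Sym n)} {y : Sym n}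
    (hy : y ∉ Z) (hY : insert y Z ∈ antichains u v I x) :
    Edge (theta u v x Z) (theta u v x (insert y Z)) := by
  obtain ⟨H, k, φ, f, -, h2, h3, h4⟩ := exists_cube hcl hY
  rw [h4 Z (Finset.subset_insert y Z), h4 _ subset_rfl]
  refine H.adj_edge _ _ (φ.map_rel_iff.2 ?_)
  obtain ⟨i, hi⟩ := h2 y (Finset.mem_insert_self y Z)
  refine Finset.covBy_iff_exists_insert.2 ⟨i, by rw [h3, hi]; exact hy, ?_⟩
  ext j
  simp only [Finset.mem_insert, h3]
  refine or_congr ?_ Iff.rfl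
  rw [← hi]
  constructor
  · rintro rfl; rfl
  · intro hj
    simpa using φ.injective (Subtype.ext hj)

lemma theta_injOn (hcl : HasHypercubeCluster u v I x) {Y Z Z' : Finset (Sym n)}
    (hY : Y ∈ antichains u v I x) (hZ : Z ⊆ Y) (hZ' : Z' ⊆ Y)
    (h : theta u v x Z = theta u v x Z') : Z = Z' := by
  obtain ⟨H, k, φ, f, -, h2, h3, h4⟩ := exists_cube hcl hY
  rw [h4 Z hZ, h4 Z' hZ'] at h
  have hf : f Z = f Z' := φ.injective (Subtype.ext h)
  ext y
  constructor
  · intro hy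
    obtain ⟨i, rfl⟩ := h2 y (hZ hy)
    rwa [← h3, ← hf, h3]
  · intro hy
    obtain ⟨i, rfl⟩ := h2 y (hZ' hy)
    rwa [← h3, hf, h3]

lemma theta_mem (hcl : HasHypercubeCluster u v I x) {Y : Finset (Sym n)}
    (hY : Y ∈ antichains u v I x) : InInterval u v (theta u v x Y) := by
  obtain ⟨H, k, φ, f, -, -, -, h4⟩ := exists_cube hcl hY
  rw [h4 Y subset_rfl]
  exact H.verts_mem _ (φ _).2

lemma empty_mem_antichains : ∅ ∈ antichains u v I x := by
  simp [mem_antichains]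

lemma theta_empty (hcl : HasHypercubeCluster u v I x) : theta u v x ∅ = x := by
  obtain ⟨H, k, φ, f, h1, -, h3, h4⟩ := exists_cube hcl (empty_mem_antichains (I := I))
  rw [h4 ∅ subset_rfl, ← h1]
  congr 2
  ext i
  simp [h3]

lemma theta_singleton (hcl : HasHypercubeCluster u v I x) {y : Sym n}
    (hy : {y} ∈ antichains u v I x) : theta u v x {y} = y := by
  obtain ⟨H, k, φ, f, -, h2, h3, h4⟩ := exists_cube hcl hy
  obtain ⟨i, hi⟩ := h2 y (by simp)
  rw [h4 {y} subset_rfl]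
  conv_rhs => rw [← hi]
  congr 2
  ext j
  rw [h3, Finset.mem_singleton, Finset.mem_singleton]
  constructor
  · intro hj
    simpa using φ.injective (Subtype.ext (hj.trans hi.symm))
  · rintro rfl; exact hi

end Cluster

/-! ### Increasing paths in hypercubes -/

lemma Edge.exists_label {n : ℕ} {a b : Sym n} (h : Edge a b) :
    ∃ t : Reflection n, b = t.1 * a :=
  ⟨⟨b * a⁻¹, h.1⟩, by simp⟩

lemma diamond_order {n : ℕ} {r : Reflection n → Reflection n → Prop} (hr : IsReflectionOrder r)
    {x : Sym n} {t₁ t₂ t₃ t₄ : Reflection n} (h : IsTwoPath x t₁ t₂) (h' : IsTwoPath x t₃ t₄)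
    (hprod : t₄.1 * (t₃.1 * x) = t₂.1 * (t₁.1 * x)) (hne : t₃ ≠ t₁) :
    (r t₁ t₂ ∧ r t₄ t₃ ∧ r t₁ t₃ ∧ r t₄ t₂) ∨ (r t₂ t₁ ∧ r t₃ t₄ ∧ r t₃ t₁ ∧ r t₂ t₄) := by
  obtain ⟨t₅, t₆, h1, -, -, h4, h5⟩ := exists_partner hr h
  have hprod' : t₄.1 * t₃.1 = t₂.1 * t₁.1 := by
    rw [← mul_assoc, ← mul_assoc] at hprod
    exact mul_right_cancel hprod
  obtain rfl := (h5 t₃ t₄ hprod' h').resolve_left hne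
  obtain rfl : t₄ = t₆ := reflection_eq_of_mul_eq (hprod'.trans h1.symm)
  exact h4

lemma isTwoPath_of_edges {n : ℕ} {x a w : Sym n} (h₁ : Edge x a) (h₂ : Edge a w)
    {t₁ t₂ : Reflection n} (e₁ : a = t₁.1 * x) (e₂ : w = t₂.1 * a) : IsTwoPath x t₁ t₂ := by
  subst e₁ e₂
  exact ⟨h₁.2, h₂.2⟩

/-- At most two vertices lie in the middle of two-step paths from `x` to `w`. -/
lemma diamond_unique {n : ℕ} {r : Reflection n → Reflection n → Prop} (hr : IsReflectionOrder r)
    {x a b c w : Sym n} (ha : Edge x a) (ha' : Edge a w) (hb : Edge x b) (hb' : Edge b w)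
    (hc : Edge x c) (hc' : Edge c w) (hba : b ≠ a) (hca : c ≠ a) : b = c := by
  obtain ⟨t₁, e₁⟩ := ha.exists_label
  obtain ⟨t₂, e₂⟩ := ha'.exists_label
  obtain ⟨t₃, e₃⟩ := hb.exists_label
  obtain ⟨t₄, e₄⟩ := hb'.exists_label
  obtain ⟨t₅, e₅⟩ := hc.exists_label
  obtain ⟨t₆, e₆⟩ := hc'.exists_label
  obtain ⟨t₇, t₈, -, -, -, -, h⟩ := exists_partner hr (isTwoPath_of_edges ha ha' e₁ e₂)
  have key : ∀ {b : Sym n} {t₃ t₄ : Reflection n}, Edge x b → Edge b w → b = t₃.1 * x →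
      w = t₄.1 * b → b ≠ a → t₃ = t₇ := by
    intro b t₃ t₄ hb hb' e₃ e₄ hba
    refine (h t₃ t₄ ?_ (isTwoPath_of_edges hb hb' e₃ e₄)).resolve_left ?_
    · rw [e₃] at e₄
      rw [e₁, e₄, ← mul_assoc, ← mul_assoc] at e₂
      exact mul_right_cancel e₂
    · rintro rfl; exact hba (e₃.trans e₁.symm)
  rw [e₃, e₅, key hb hb' e₃ e₄ hba, key hc hc' e₅ e₆ hca]

section Cluster

variable {n : ℕ} {u v : Sym n} {I : Finset (Sym n)} {x : Sym n}

lemma theta_diamond_order {r : Reflection n → Reflection n → Prop} (hr : IsReflectionOrder r)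
    (hcl : HasHypercubeCluster u v I x) {Z : Finset (Sym n)} {y z : Sym n} (hyz : y ≠ z)
    (hy : y ∉ Z) (hz : z ∉ Z) (hY : insert y (insert z Z) ∈ antichains u v I x)
    {t₁ t₂ t₃ t₄ : Reflection n}
    (e₁ : theta u v x (insert z Z) = t₁.1 * theta u v x Z)
    (e₂ : theta u v x (insert y (insert z Z)) = t₂.1 * theta u v x (insert z Z))
    (e₃ : theta u v x (insert y Z) = t₃.1 * theta u v x Z)
    (e₄ : theta u v x (insert y (insert z Z)) = t₄.1 * theta u v x (insert y Z)) :
    (r t₁ t₂ ∧ r t₄ t₃ ∧ r t₁ t₃ ∧ r t₄ t₂) ∨ (r t₂ t₁ ∧ r t₃ t₄ ∧ r t₃ t₁ ∧ r t₂ t₄) := by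
  have hsub : insert y Z ⊆ insert y (insert z Z) :=
    Finset.insert_subset_insert _ (Finset.subset_insert _ _)
  have hsub' : insert z Z ⊆ insert y (insert z Z) := Finset.subset_insert _ _
  have hY' := antichains_mono hY hsub
  have hZ' := antichains_mono hY hsub'
  have hyz' : y ∉ insert z Z := by simp [hyz, hy]
  have hzy' : z ∉ insert y Z := by simp [hyz.symm, hz]
  have hcomm : insert y (insert z Z) = insert z (insert y Z) := Finset.insert_comm _ _ _
  refine diamond_order hr
    (isTwoPath_of_edges (theta_edge hcl hz hZ') (theta_edge hcl hyz' hY) e₁ e₂)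
    (isTwoPath_of_edges (theta_edge hcl hy hY')
      (theta_edge hcl hzy' (hcomm ▸ hY)) e₃ (hcomm ▸ e₄)) ?_ ?_
  · rw [← e₃, ← e₄, ← e₁, ← e₂]
  · rintro rfl
    have := theta_injOn hcl hY hsub hsub' (e₃.trans e₁.symm)
    exact hyz' (this ▸ Finset.mem_insert_self y Z)

lemma insert_injective_of_theta_eq {r : Reflection n → Reflection n → Prop}
    (hr : IsReflectionOrder r) (hcl : HasHypercubeCluster u v I x) (Z : Finset (Sym n))
    {y y' : Sym n} (hy : y ∉ Z) (hy' : y' ∉ Z) (hY : insert y Z ∈ antichains u v I x)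
    (hY' : insert y' Z ∈ antichains u v I x)
    (h : theta u v x (insert y Z) = theta u v x (insert y' Z)) : y = y' := by
  induction Z using Finset.induction_on with
  | empty =>
    simp only [insert_empty_eq] at hY hY' h
    rwa [theta_singleton hcl hY, theta_singleton hcl hY'] at h
  | insert z Z hz ih =>
    rw [Finset.mem_insert, not_or] at hy hy'
    have face : ∀ {y : Sym n}, y ≠ z → y ∉ Z → insert y (insert z Z) ∈ antichains u v I x →
        insert y Z ∈ antichains u v I x ∧
        Edge (theta u v x Z) (theta u v x (insert y Z)) ∧
        Edge (theta u v x (insert y Z)) (theta u v x (insert y (insert z Z))) ∧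
        theta u v x (insert y Z) ≠ theta u v x (insert z Z) := by
      intro y hyz hyZ hY
      have hsub : insert y Z ⊆ insert y (insert z Z) :=
        Finset.insert_subset_insert _ (Finset.subset_insert _ _)
      have hA := antichains_mono hY hsub
      refine ⟨hA, theta_edge hcl hyZ hA, ?_, fun hc => ?_⟩
      · rw [Finset.insert_comm] at hY ⊢
        exact theta_edge hcl (by simp [hyz.symm, hz]) hY
      · have := theta_injOn hcl hY hsub (Finset.subset_insert _ _) hc
        have h1 : y ∈ insert z Z := this ▸ Finset.mem_insert_self y Z
        simp [hyz, hyZ] at h1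
    obtain ⟨a1, a2, a3, a4⟩ := face hy.1 hy.2 hY
    obtain ⟨b1, b2, b3, b4⟩ := face hy'.1 hy'.2 hY'
    rw [← h] at b3
    have hzA := antichains_mono hY (Finset.subset_insert y _)
    refine ih hy.2 hy'.2 a1 b1 (diamond_unique hr (theta_edge hcl hz hzA)
      (theta_edge hcl (by simp [hy]) hY) a2 a3 b2 b3 a4 b4)

/-- The path in the hypercube spanned by the elements of a list, which are added one by one
starting from the end of the list, has the labels `l`, again read from the end. -/
def Follows (u v : Sym n) (I : Finset (Sym n)) (x : Sym n) :
    List (Sym n) → List (Reflection n) → Prop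
  | [], [] => True
  | y :: ys, t :: l => Follows u v I x ys l ∧ y ∉ ys ∧
      insert y ys.toFinset ∈ antichains u v I x ∧
      theta u v x (insert y ys.toFinset) = t.1 * theta u v x ys.toFinset
  | _, _ => False

lemma Follows.mem_antichains {ys : List (Sym n)} {l : List (Reflection n)}
    (h : Follows u v I x ys l) : ys.toFinset ∈ antichains u v I x := by
  cases ys with
  | nil => exact empty_mem_antichains
  | cons y ys =>
    cases l with
    | nil => exact h.elim
    | cons t l => rw [List.toFinset_cons]; exact h.2.2.1

lemma Follows.length_eq {ys : List (Sym n)} {l : List (Reflection n)}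
    (h : Follows u v I x ys l) : l.length = ys.toFinset.card := by
  induction ys generalizing l with
  | nil =>
    cases l with
    | nil => rfl
    | cons t l => exact h.elim
  | cons y ys ih =>
    cases l with
    | nil => exact h.elim
    | cons t l =>
      rw [List.toFinset_cons, Finset.card_insert_of_notMem (by simpa using h.2.1), ← ih h.1,
        List.length_cons]

lemma Follows.isPathTo (hcl : HasHypercubeCluster u v I x) {ys : List (Sym n)}
    {l : List (Reflection n)} (h : Follows u v I x ys l) :
    IsPathTo x l (theta u v x ys.toFinset) := by
  induction ys generalizing l with
  | nil =>
    cases l with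
    | nil => exact (theta_empty hcl).symm
    | cons t l => exact h.elim
  | cons y ys ih =>
    cases l with
    | nil => exact h.elim
    | cons t l =>
      obtain ⟨h1, h2, h3, h4⟩ := h
      have hE := theta_edge hcl (by simpa using h2) h3
      rw [List.toFinset_cons]
      have e : t.1 * theta u v x (insert y ys.toFinset) = theta u v x ys.toFinset := by
        rw [h4, t.mul_mul_cancel]
      exact ⟨by rw [e]; exact hE.2, by rw [e]; exact ih h1⟩

lemma Follows.right_unique {ys : List (Sym n)} {l l' : List (Reflection n)}
    (h : Follows u v I x ys l) (h' : Follows u v I x ys l') : l = l' := by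
  induction ys generalizing l l' with
  | nil => cases l <;> cases l' <;> simp_all [Follows]
  | cons y ys ih =>
    cases l with
    | nil => exact h.elim
    | cons t l =>
      cases l' with
      | nil => exact h'.elim
      | cons t' l' =>
        rw [ih h.1 h'.1, reflection_eq_of_mul_eq (h.2.2.2.symm.trans h'.2.2.2)]

lemma Follows.left_unique {r : Reflection n → Reflection n → Prop} (hr : IsReflectionOrder r)
    (hcl : HasHypercubeCluster u v I x) {ys ys' : List (Sym n)} {l : List (Reflection n)}
    (h : Follows u v I x ys l) (h' : Follows u v I x ys' l) : ys = ys' := by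
  induction l generalizing ys ys' with
  | nil => cases ys <;> cases ys' <;> simp_all [Follows]
  | cons t l ih =>
    cases ys with
    | nil => exact h.elim
    | cons y ys =>
      cases ys' with
      | nil => exact h'.elim
      | cons y' ys' =>
        obtain ⟨h1, h2, h3, h4⟩ := h
        obtain ⟨h1', h2', h3', h4'⟩ := h'
        obtain rfl := ih h1 h1'
        rw [insert_injective_of_theta_eq hr hcl ys.toFinset (by simpa using h2)
          (by simpa using h2') h3 h3' (h4.trans h4'.symm)]

/-- Every antichain has an ordering whose path is increasing. -/
lemma exists_follows {r : Reflection n → Reflection n → Prop} (hr : IsReflectionOrder r)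
    (hcl : HasHypercubeCluster u v I x) (Y : Finset (Sym n)) (hY : Y ∈ antichains u v I x) :
    ∃ ys l, Follows u v I x ys l ∧ ys.toFinset = Y ∧ l.Pairwise fun a b => r b a := by
  classical
  have := hr.1
  induction hk : Y.card generalizing Y with
  | zero =>
    rw [Finset.card_eq_zero] at hk
    subst hk
    exact ⟨[], [], trivial, rfl, List.Pairwise.nil⟩
  | succ k ih =>
    have hne : Y.Nonempty := Finset.card_pos.1 (by omega)
    have hlab : ∀ y : Y, ∃ t : Reflection n,
        theta u v x Y = t.1 * theta u v x (Y.erase y) := by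
      rintro ⟨y, hy⟩
      have := theta_edge hcl (Finset.notMem_erase y Y) (by rwa [Finset.insert_erase hy])
      rw [Finset.insert_erase hy] at this
      exact this.exists_label
    choose τ hτ using hlab
    obtain ⟨⟨y, hy⟩, -, hmax⟩ :=
      let _ : LinearOrder (Reflection n) := linearOrderOfSTO r
      Finset.exists_max_image Y.attach τ (Finset.attach_nonempty_iff.2 hne)
    have hmax' : ∀ z (hz : z ∈ Y), ¬ r (τ ⟨y, hy⟩) (τ ⟨z, hz⟩) := by
      intro z hz hlt
      let _ : LinearOrder (Reflection n) := linearOrderOfSTO r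
      exact absurd hlt (not_lt.2 (hmax ⟨z, hz⟩ (Finset.mem_attach _ _)))
    obtain ⟨ys, l, h1, h2, h3⟩ := ih (Y.erase y) (antichains_mono hY (Finset.erase_subset _ _))
      (by rw [Finset.card_erase_of_mem hy]; omega)
    have hyys : y ∉ ys := by rw [← List.mem_toFinset, h2]; simp
    refine ⟨y :: ys, τ ⟨y, hy⟩ :: l, ⟨h1, hyys, ?_, ?_⟩, ?_, ?_⟩
    · rwa [h2, Finset.insert_erase hy]
    · rw [h2, Finset.insert_erase hy]; exact hτ ⟨y, hy⟩
    · rw [List.toFinset_cons, h2, Finset.insert_erase hy]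
    · refine List.pairwise_cons.2 ⟨?_, h3⟩
      cases l with
      | nil => simp
      | cons t₁ l =>
        cases ys with
        | nil => exact h1.elim
        | cons z zs =>
          obtain ⟨-, hz, hA, e₁⟩ := h1
          rw [List.toFinset_cons] at h2
          have hYeq : insert y (insert z zs.toFinset) = Y := by
            rw [h2, Finset.insert_erase hy]
          have hyz : y ≠ z := by rintro rfl; simp at hyys
          have hyzs : y ∉ zs.toFinset := by
            rw [List.mem_toFinset]; exact fun hc => hyys (by simp [hc])
          have hzzs : z ∉ zs.toFinset := by simpa using hz
          have hzY : z ∈ Y := by rw [← hYeq]; simp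
          have herase : insert y zs.toFinset = Y.erase z := by
            rw [← hYeq, Finset.insert_comm, Finset.erase_insert (by simp [hyz.symm, hzzs])]
          have e₂ : theta u v x (insert y (insert z zs.toFinset)) =
              (τ ⟨y, hy⟩).1 * theta u v x (insert z zs.toFinset) := by
            rw [hYeq, h2]; exact hτ ⟨y, hy⟩
          have e₄ : theta u v x (insert y (insert z zs.toFinset)) =
              (τ ⟨z, hzY⟩).1 * theta u v x (insert y zs.toFinset) := by
            rw [hYeq, herase]; exact hτ ⟨z, hzY⟩
          obtain ⟨t₃, e₃⟩ := (theta_edge hcl hyzs (herase ▸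
            antichains_mono hY (Finset.erase_subset _ _))).exists_label
          have key : r t₁ (τ ⟨y, hy⟩) := by
            rcases theta_diamond_order hr hcl hyz hyzs hzzs (hYeq ▸ hY) e₁ e₂ e₃ e₄ with h | h
            · exact h.1
            · exact absurd h.2.2.2 (hmax' z hzY)
          intro t ht
          rcases List.mem_cons.1 ht with rfl | ht
          · exact key
          · exact trans_of r ((List.pairwise_cons.1 h3).1 t ht) key

/-- The last label of the increasing path of a hypercube is larger than the labels of all other
edges ending in the top vertex. -/
lemma Follows.last_label_max {r : Reflection n → Reflection n → Prop} (hr : IsReflectionOrder r)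
    (hcl : HasHypercubeCluster u v I x) {ys : List (Sym n)} {y : Sym n}
    {l : List (Reflection n)} {t : Reflection n} (h : Follows u v I x (y :: ys) (t :: l))
    (hl : (t :: l).Pairwise fun a b => r b a) {z : Sym n} (hz : z ∈ ys) {t' : Reflection n}
    (ht' : theta u v x (insert y ys.toFinset) =
      t'.1 * theta u v x (insert y (ys.toFinset.erase z))) : r t' t := by
  have := hr.1
  induction ys generalizing y l t t' with
  | nil => simp at hz
  | cons z₀ zs ih =>
    cases l with
    | nil => exact h.1.elim
    | cons s l =>
      obtain ⟨h1, h2, h3, h4⟩ := h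
      rw [List.pairwise_cons] at hl
      have hst : r s t := hl.1 s (by simp)
      set Ys := (z₀ :: zs).toFinset with hYs
      have hzYs : z ∈ Ys := by rw [hYs, List.mem_toFinset]; exact hz
      have hyYs : y ∉ Ys := by rw [hYs, List.mem_toFinset]; exact h2
      set Z := Ys.erase z with hZ
      have hins : insert z Z = Ys := Finset.insert_erase hzYs
      have hzZ : z ∉ Z := Finset.notMem_erase _ _
      have hyZ : y ∉ Z := fun hc => hyYs (Finset.mem_of_mem_erase hc)
      have hyz : y ≠ z := by rintro rfl; exact hyYs hzYs
      obtain ⟨s', e₁⟩ := (theta_edge hcl hzZ (by rw [hins]; exact h1.mem_antichains)).exists_label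
      have hs't : r s' t := by
        by_cases hzz : z = z₀
        · subst hzz
          have hZ' : Z = zs.toFinset := by
            rw [hZ, hYs, List.toFinset_cons, Finset.erase_insert (by simpa using h1.2.1)]
          have : s' = s := by
            apply reflection_eq_of_mul_eq (a := theta u v x Z)
            rw [← e₁, hZ', h1.2.2.2]
          rw [this]; exact hst
        · have hz' : z ∈ zs := by simpa [hzz] using hz
          refine trans_of r (ih h1 hl.2 hz' ?_) hst
          have hZ' : Z = insert z₀ (zs.toFinset.erase z) := by
            rw [hZ, hYs, List.toFinset_cons, Finset.erase_insert_of_ne (Ne.symm hzz)]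
          rw [← hZ', ← e₁, hins, hYs, List.toFinset_cons]
      rw [← hins] at h3 h4 ht'
      obtain ⟨t₃, e₃⟩ := (theta_edge hcl hyZ (antichains_mono h3
        (Finset.insert_subset_insert _ (Finset.subset_insert _ _)))).exists_label
      rcases theta_diamond_order hr hcl hyz hyZ hzZ h3 e₁ h4 e₃ ht' with h | h
      · exact h.2.2.2
      · exact absurd h.1 (asymm_of r hs't)

lemma Follows.eq_of_toFinset_eq {r : Reflection n → Reflection n → Prop}
    (hr : IsReflectionOrder r) (hcl : HasHypercubeCluster u v I x) {ys ys' : List (Sym n)}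
    {l l' : List (Reflection n)} (h : Follows u v I x ys l) (h' : Follows u v I x ys' l')
    (hl : l.Pairwise fun a b => r b a) (hl' : l'.Pairwise fun a b => r b a)
    (heq : ys.toFinset = ys'.toFinset) : ys = ys' := by
  have := hr.1
  induction ys generalizing ys' l l' with
  | nil =>
    rw [List.toFinset_nil, eq_comm, List.toFinset_eq_empty_iff] at heq
    exact heq.symm
  | cons y ys ih =>
    cases ys' with
    | nil => simp at heq
    | cons y' ys' =>
      cases l with
      | nil => exact h.elim
      | cons t l =>
        cases l' with
        | nil => exact h'.elim
        | cons t' l' =>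
          rw [List.toFinset_cons, List.toFinset_cons] at heq
          have hy : y ∉ ys.toFinset := by simpa using h.2.1
          have hy' : y' ∉ ys'.toFinset := by simpa using h'.2.1
          by_cases hyy : y = y'
          · subst hyy
            have heq' : ys.toFinset = ys'.toFinset := by
              rw [← Finset.erase_insert hy, heq, Finset.erase_insert hy']
            rw [ih h.1 h'.1 (List.pairwise_cons.1 hl).2 (List.pairwise_cons.1 hl').2 heq']
          · exfalso
            have m1 : y' ∈ ys := by
              have : y' ∈ insert y ys.toFinset := by rw [heq]; simp
              simpa [Ne.symm hyy] using this
            have m2 : y ∈ ys' := by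
              have : y ∈ insert y' ys'.toFinset := by rw [← heq]; simp
              simpa [hyy] using this
            have f1 : insert y (ys.toFinset.erase y') = ys'.toFinset := by
              rw [← Finset.erase_insert_of_ne hyy, heq, Finset.erase_insert hy']
            have f2 : insert y' (ys'.toFinset.erase y) = ys.toFinset := by
              rw [← Finset.erase_insert_of_ne (Ne.symm hyy), ← heq, Finset.erase_insert hy]
            have r1 := h.last_label_max hr hcl hl m1 (t' := t')
              (by rw [f1, heq]; exact h'.2.2.2)
            have r2 := h'.last_label_max hr hcl hl' m2 (t' := t)
              (by rw [f2, ← heq]; exact h.2.2.2)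
            exact asymm_of r r1 r2

end Cluster

/-! ### Increasing paths leaving the ideal -/

section Cluster

variable {n : ℕ} {u v : Sym n} {I : Finset (Sym n)} {x : Sym n}

lemma Follows.exists_cons (hI : IsOrderIdeal u v I) (hx : x ∈ I)
    (hcl : HasHypercubeCluster u v I x) (hstrong : IsStrong u v I x)
    {r : Reflection n → Reflection n → Prop} (hr : IsReflectionOrder r)
    (hE : ∀ (x₁ x₂ : Sym n) (e₁ : Edge x₁ x₂), x₁ ∈ I → InInterval x v x₁ → x₂ ∈ I →
      InInterval x v x₂ → IsSmall r v I x ⟨x₂ * x₁⁻¹, e₁.1⟩)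
    {ys : List (Sym n)} {l : List (Reflection n)} (h : Follows u v I x ys l)
    {t : Reflection n} (hl : (t :: l).Pairwise fun a b => r b a)
    (hup : length (theta u v x ys.toFinset) < length (t.1 * theta u v x ys.toFinset))
    (hv : BruhatLE (t.1 * theta u v x ys.toFinset) v)
    (hnil : ys = [] → t.1 * theta u v x ys.toFinset ∉ I) :
    ∃ y, Follows u v I x (y :: ys) (t :: l) := by
  have := hr.1
  have hux : BruhatLE u x := (hI.1 x hx).1
  induction ys generalizing l t with
  | nil =>
    cases l with
    | cons s l => exact h.elim
    | nil =>
      rw [List.toFinset_nil, theta_empty hcl] at hup hv hnil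
      have hedge : Edge x (t.1 * x) := ⟨by rw [label_mul]; exact t.2, hup⟩
      have hA : {t.1 * x} ∈ antichains u v I x := by
        rw [BruhatHypercube.mem_antichains]
        refine ⟨fun y hy => ?_, by simp⟩
        rw [Finset.mem_singleton] at hy
        subst hy
        exact ⟨⟨hux.trans hedge.le, hv⟩, hnil rfl, hedge⟩
      refine ⟨t.1 * x, trivial, by simp, by simpa using hA, ?_⟩
      rw [List.toFinset_nil, theta_empty hcl, insert_empty_eq, theta_singleton hcl hA]
  | cons z zs ih =>
    cases l with
    | nil => exact h.elim
    | cons s l =>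
      have hfull := h
      obtain ⟨h1, h2, h3, h4⟩ := h
      rw [List.pairwise_cons] at hl
      have hst : r s t := hl.1 s (by simp)
      rw [List.toFinset_cons] at hup hv hnil
      have hzs : z ∉ zs.toFinset := by simpa using h2
      have hE1 := theta_edge hcl hzs h3
      set a := theta u v x zs.toFinset with ha
      have hpath : IsTwoPath a s t := by
        rw [h4] at hup hE1
        exact ⟨hE1.2, hup⟩
      obtain ⟨t₃, t₄, p1, p2, p3, p4, -⟩ := exists_partner hr hpath
      obtain ⟨-, o2, o3, -⟩ := p4.resolve_right fun hc => asymm_of r hst hc.1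
      set w := t.1 * theta u v x (insert z zs.toFinset) with hw
      have hw' : w = t₄.1 * (t₃.1 * a) := by
        rw [hw, h4, ← mul_assoc, ← mul_assoc, p1]
      have hEb : Edge a (t₃.1 * a) := ⟨by rw [label_mul]; exact t₃.2, p2.1⟩
      have hEw : Edge (t₃.1 * a) w := by
        rw [hw']; exact ⟨by rw [label_mul]; exact t₄.2, p2.2⟩
      have hEzw : Edge (theta u v x (insert z zs.toFinset)) w :=
        ⟨by rw [hw, label_mul]; exact t.2, hup⟩
      have hul : BruhatLE u a := (theta_mem hcl h1.mem_antichains).1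
      obtain ⟨y, hy⟩ := ih h1 (t := t₃)
        (List.pairwise_cons.2 ⟨fun m hm =>
          trans_of r ((List.pairwise_cons.1 hl.2).1 m hm) o3, (List.pairwise_cons.1 hl.2).2⟩)
        p2.1 (hEw.le.trans hv) (by
          rintro rfl hbI
          have hax : a = x := by rw [ha, List.toFinset_nil, theta_empty hcl]
          have hz1 : theta u v x (insert z ([] : List (Sym n)).toFinset) = z :=
            theta_singleton hcl h3
          have hzI : z ∉ I := ((BruhatHypercube.mem_antichains.1 h3).1 z (by simp)).2.1
          have hwI : w ∉ I := by
            intro hwI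
            rw [hz1] at hEzw
            exact hzI (hI.2 w hwI z ((BruhatHypercube.mem_antichains.1 h3).1 z (by simp)).1
              hEzw.le)
          rw [hax] at hEb hEw hbI hw'
          have hbv := hEw.le.trans hv
          have hsm := hE x _ hEb hx ⟨BruhatLE.refl x, hEb.le.trans hbv⟩ hbI ⟨hEb.le, hbv⟩
          have := hsm _ _ hEw hbI ⟨hEb.le, hbv⟩ hwI ⟨hEb.le.trans hEw.le, hv⟩
          simp only [label_mul, hw'] at this
          exact asymm_of r o2 this)
      obtain ⟨-, y2, y3, y4⟩ := hy
      rw [← ha] at y4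
      have hyzs : y ∉ zs.toFinset := by simpa using y2
      have hyz : y ≠ z := by
        rintro rfl
        exact p3 (reflection_eq_of_mul_eq (y4.symm.trans h4))
      have hinter : insert z zs.toFinset ∩ insert y zs.toFinset = zs.toFinset := by
        ext m
        simp only [Finset.mem_inter, Finset.mem_insert]
        constructor
        · rintro ⟨rfl | h, rfl | h'⟩
          · exact absurd rfl hyz
          · exact h'
          · exact h
          · exact h
        · exact fun h => ⟨Or.inr h, Or.inr h⟩
      have hunion : insert z zs.toFinset ∪ insert y zs.toFinset =
          insert y (insert z zs.toFinset) := by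
        rw [Finset.insert_union, Finset.union_insert, Finset.union_self, Finset.insert_comm]
      have hc₁ : (insert z zs.toFinset).card =
          (insert z zs.toFinset ∩ insert y zs.toFinset).card + 1 := by
        rw [hinter, Finset.card_insert_of_notMem hzs]
      have hc₂ : (insert y zs.toFinset).card =
          (insert z zs.toFinset ∩ insert y zs.toFinset).card + 1 := by
        rw [hinter, Finset.card_insert_of_notMem hyzs]
      have hne : theta u v x (insert z zs.toFinset) ≠ theta u v x (insert y zs.toFinset) :=
        fun hc => p3 (reflection_eq_of_mul_eq (y4.symm.trans (hc.symm.trans h4)))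
      have hS := hstrong (insert z zs.toFinset) h3 (insert y zs.toFinset) y3 hc₁ hc₂ w
        ⟨hul.trans (hEb.le.trans hEw.le), hv⟩ hne
      rw [hinter, y4] at hS
      replace hS := hS hE1 hEb hEzw hEw
      rw [hunion] at hS
      refine ⟨y, hfull, ?_, ?_, ?_⟩
      · simpa [hyz] using y2
      · rw [List.toFinset_cons]; exact hS.1
      · rw [List.toFinset_cons]; exact hS.2

lemma exists_follows_of_isPathTo (hI : IsOrderIdeal u v I) (hx : x ∈ I)
    (hcl : HasHypercubeCluster u v I x) (hstrong : IsStrong u v I x)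
    {r : Reflection n → Reflection n → Prop} (hr : IsReflectionOrder r)
    (hE : ∀ (x₁ x₂ : Sym n) (e₁ : Edge x₁ x₂), x₁ ∈ I → InInterval x v x₁ → x₂ ∈ I →
      InInterval x v x₂ → IsSmall r v I x ⟨x₂ * x₁⁻¹, e₁.1⟩)
    {l : List (Reflection n)} (hl : l.Pairwise fun a b => r b a)
    (hsmall : ∀ t ∈ l, ¬ IsSmall r v I x t) {w : Sym n} (hw : BruhatLE w v)
    (hpath : IsPathTo x l w) :
    ∃ ys, Follows u v I x ys l ∧ theta u v x ys.toFinset = w := by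
  induction l generalizing w with
  | nil => exact ⟨[], trivial, (theta_empty hcl).trans hpath⟩
  | cons t l ih =>
    obtain ⟨hlt, hpath⟩ := hpath
    have hedge := edge_mul t hlt
    obtain ⟨ys, h1, h2⟩ := ih (List.pairwise_cons.1 hl).2 (fun t ht => hsmall t (by simp [ht]))
      (hedge.le.trans hw) hpath
    have e : t.1 * theta u v x ys.toFinset = w := by rw [h2, t.mul_mul_cancel]
    obtain ⟨y, hy⟩ := h1.exists_cons hI hx hcl hstrong hr hE hl (by rw [e, h2]; exact hlt)
      (by rwa [e]) (by
        rintro rfl hwI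
        rw [e] at hwI
        rw [List.toFinset_nil, theta_empty hcl] at h2
        rw [← h2] at hedge
        have := hE _ _ hedge hx ⟨BruhatLE.refl x, hedge.le.trans hw⟩ hwI ⟨hedge.le, hw⟩
        refine hsmall t (by simp) ?_
        convert this using 1
        apply Subtype.ext
        simp only [h2, label_mul'])
    refine ⟨y :: ys, hy, ?_⟩
    rw [List.toFinset_cons, hy.2.2.2, e]

lemma Follows.not_isSmall (hx : x ∈ I) (hcl : HasHypercubeCluster u v I x)
    {r : Reflection n → Reflection n → Prop} [IsStrictTotalOrder _ r]
    {ys : List (Sym n)} {l : List (Reflection n)} (h : Follows u v I x ys l)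
    (hl : l.Pairwise fun a b => r b a) : ∀ t ∈ l, ¬ IsSmall r v I x t := by
  induction ys generalizing l with
  | nil =>
    cases l with
    | nil => simp
    | cons t l => exact h.elim
  | cons y ys ih =>
    cases l with
    | nil => simp
    | cons t l =>
      rw [List.pairwise_cons] at hl
      have ih' := ih h.1 hl.2
      intro t' ht'
      rcases List.mem_cons.1 ht' with rfl | ht'
      · cases l with
        | cons s l => exact fun hc => ih' s (by simp) (hc.of_lt (hl.1 s (by simp)))
        | nil =>
          cases ys with
          | cons z zs => exact h.1.elim
          | nil =>
            obtain ⟨-, -, h3, h4⟩ := h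
            rw [List.toFinset_nil, theta_empty hcl, insert_empty_eq] at h4
            rw [List.toFinset_nil, insert_empty_eq] at h3
            rw [theta_singleton hcl h3] at h4
            obtain ⟨hy1, hy2, hy3⟩ := (BruhatHypercube.mem_antichains.1 h3).1 y (by simp)
            have e : t'.1 * y = x := by rw [h4, t'.mul_mul_cancel]
            refine IsSmall.not_of_leaving (y := y) ?_ ?_ ?_ hy2 ⟨hy3.le, hy1.2⟩
            · rw [e]; exact hy3.2
            · rwa [e]
            · rw [e]; exact ⟨BruhatLE.refl x, hy3.le.trans hy1.2⟩
      · exact ih' t' ht'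

end Cluster

end BruhatHypercube

open BruhatHypercube in
theorem theorem3p5 (n : ℕ) (u v : Sym n) (I : Finset (Sym n))
    (hI : IsOrderIdeal u v I) (hdiamond : DiamondClosed u v I)
    (x : Sym n) (hx : x ∈ I)
    (hcluster : HasHypercubeCluster u v I x)
    (hstrong : IsStrong u v I x) (hE : PropertyE v I x) :
    relRTilde x v I =
      ∑ Y ∈ antichains u v I x with theta u v x Y = v, X ^ Y.card := by
  classical
  obtain ⟨r, hr, hE⟩ := hE
  have := hr.1
  have hE' : ∀ (x₁ x₂ : Sym n) (e₁ : Edge x₁ x₂), x₁ ∈ I → InInterval x v x₁ → x₂ ∈ I →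
      InInterval x v x₂ → IsSmall r v I x ⟨x₂ * x₁⁻¹, e₁.1⟩ :=
    fun x₁ x₂ e₁ h1 h2 h3 h4 z y e h5 h6 h7 h8 => hE x₁ x₂ z y e₁ e h1 h2 h3 h4 h5 h6 h7 h8
  obtain ⟨L, hL⟩ := hr.exists_isListing
  set L' := L.filter fun t => ! decide (IsSmall r v I x t) with hL'
  have hsorted : L'.Pairwise fun a b => r b a := hL.1.sublist List.filter_sublist
  have hnodup : ∀ {l : List (Reflection n)}, l.Pairwise (fun a b => r b a) → l.Nodup :=
    fun h => h.imp fun hab => by rintro rfl; exact irrefl_of r _ hab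
  have hmem : ∀ l, l ∈ L'.sublists' ↔
      l.Pairwise (fun a b => r b a) ∧ ∀ t ∈ l, ¬ IsSmall r v I x t := by
    intro l
    rw [List.mem_sublists']
    constructor
    · exact fun h => ⟨hsorted.sublist h, fun t ht => by simpa [hL', hL.2] using h.subset ht⟩
    · rintro ⟨h1, h2⟩
      have : Std.Antisymm fun a b => r b a := ⟨fun a b h h' => absurd h (asymm_of r h')⟩
      exact List.sublist_of_subperm_of_pairwise
        (List.subperm_of_subset (hnodup h1) fun t ht => by simpa [hL', hL.2] using h2 t ht)
        h1 hsorted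
  rw [relRTilde_eq_pathGF hI hx hr hE' hL, pathGF_eq_sum _ (hnodup hsorted)]
  symm
  have hex := exists_follows hr hcluster
  choose ys l hfol hys hl using hex
  refine Finset.sum_bij (fun Y hY => l Y (Finset.mem_filter.1 hY).1) ?_ ?_ ?_ ?_
  · intro Y hY
    obtain ⟨hY, hv⟩ := Finset.mem_filter.1 hY
    rw [Finset.mem_filter, List.mem_toFinset, hmem]
    refine ⟨⟨hl Y hY, (hfol Y hY).not_isSmall hx hcluster (hl Y hY)⟩, ?_⟩
    have := (hfol Y hY).isPathTo hcluster
    rwa [hys, hv] at this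
  · intro Y hY Y' hY' heq
    have h1 := hfol Y (Finset.mem_filter.1 hY).1
    rw [heq] at h1
    rw [← hys Y (Finset.mem_filter.1 hY).1, ← hys Y' (Finset.mem_filter.1 hY').1,
      h1.left_unique hr hcluster (hfol Y' (Finset.mem_filter.1 hY').1)]
  · intro l₀ hl₀
    rw [Finset.mem_filter, List.mem_toFinset, hmem] at hl₀
    obtain ⟨⟨h1, h2⟩, h3⟩ := hl₀
    obtain ⟨zs, hzs, hv⟩ := exists_follows_of_isPathTo hI hx hcluster hstrong hr hE' h1 h2
      (BruhatLE.refl v) h3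
    have hY := hzs.mem_antichains
    refine ⟨zs.toFinset, Finset.mem_filter.2 ⟨hY, hv⟩, ?_⟩
    have e := (hfol _ hY).eq_of_toFinset_eq hr hcluster hzs (hl _ hY) h1 (hys _ hY)
    have hf := hfol _ hY
    rw [e] at hf
    exact hf.right_unique hzs
  · intro Y hY
    rw [(hfol Y (Finset.mem_filter.1 hY).1).length_eq, hys]
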